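/- Let $W$ be an $\omega$-semiring, i.e. a (not necessarily commutative) semiring in which every countable family has a sum, where these sums extend the finite ones, are invariant under re-indexing and under grouping along any partition, and multiplication distributes over them on both sides. Assume that the natural preorder of $W$ ($a\le b$ iff $a+c=b$ for some $c$) is a partial order. Let $A$ be an at most countable set, $X$ a set, $T=\mathcal F_W$ the monad of $W$-valued functions with at most countable support ($\mathcal F_W f(\varphi)(y)=\sum_{x\in f^{-1}(y)}\varphi(x)$; $\eta(x)(y)=1$ if $x=y$ and $0$ otherwise; $\mu(\psi)(x)=\sum_\varphi\psi(\varphi)\,\varphi(x)$), $F=A\times-$, with the canonical distributive law $\lambda:FT\Rightarrow TF$, and $F_\tau X=X+FX$. Arrows into $TY$ are ordered pointwise, and joins $\sqcup$ are least upper bounds in this order. **Weak $W$-bisimulation.** A $TF_\tau$-coalgebra $\alpha:X\to T(X+A\times X)$ corresponds to the image-countable $W$-LTS with labels $A+\{\tau\}$ and weights $\rho(x\xrightarrow{\tau}y)=\alpha(x)(\iota_1 y)$, $\rho(x\xrightarrow{a}y)=\alpha(x)(\iota_2(a,y))$. An execution path is a finite sequence of transitions of nonzero weight; its weight is the ordered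 product of the weights of its transitions. For a set of traces $Z$ and $C\subseteq X$ let $\rho(x,Z,C)$ be the sum of the weights of all execution paths from $x$ that end in $C$ with trace in $Z$ and have no proper prefix ending in $C$ with trace in $Z$. A weak $W$-bisimulation is an equivalence relation $\approx$ on $X$ such that $x\approx x'$ implies $\rho(x,\tau^*a\tau^*,C)=\rho(x',\tau^*a\tau^*,C)$ and $\rho(x,\tau^*,C)=\rho(x',\tau^*,C)$ for all $a\in A$ and all equivalence classes $C$. Two states are weakly $W$-bisimilar if some weak $W$-bisimulation relates them. **Coalgebraic weak bisimulation.** For $\kappa:Y\to T(Y+B)$, the trace $\mathrm{tr}_\kappa:Y\to T(\mathbb N\cdot B)$ is the homomorphism, in the Kleisli category of $T$, from $\kappa$ to the final coalgebra $\mathbb N\cdot B$ of the lifting of $-+B$, and the iterate $\mathrm{itr}_\kappa:Y\to TB$ is $\mathrm{tr}_\kappa$ followed by the codiagonal $\nabla:\mathbb N\cdot B\to B$. Let $\alpha$ be a $TF_\tau$-coalgebra on $X$ and $f:X\to C$ a map. The silent and observable parts $\alpha^s:X\to TX$, $\alpha^o:X\to TFX$ are the greatest arrows with $\alpha=(T\iota_1\circ\alpha^s)\sqcup(T\iota_2\circ\alpha^o)$.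 For $c\in C$ put $X_c=f^{-1}(c)$ and $\overline X_c=X\setminus X_c$; let $\alpha^+_c:\overline X_c\to T(X_c)$ be the iterate of the restriction $\alpha^s_c:\overline X_c\to T(\overline X_c+X_c)$ of $\alpha^s$. Let $\alpha^+(x)\in TX$ be the join of the $\alpha^+_c(x)$ over all $c\neq f(x)$, and put $\alpha^\tau=\eta\sqcup\alpha^+$, $\alpha^\flat=\mu\circ T\lambda\circ TF\alpha^\tau\circ\mathrm{itr}_\alpha$. The weak saturation of $\alpha$ with respect to $f$ is $\alpha^w=(T\iota_1\circ\alpha^\tau)\sqcup(T\iota_2\circ\alpha^\flat)$. A jointly monic span $X\xleftarrow{p}R\xrightarrow{q}Y$ is a coalgebraic weak bisimulation between $TF_\tau$-coalgebras $\alpha$ on $X$ and $\beta$ on $Y$ if there are a jointly epic cospan $X\xrightarrow{f}C\xleftarrow{g}Y$ and a coalgebra $\gamma:C\to TF_\tau C$ with $\gamma\circ f=TF_\tau f\circ\alpha^w$ and $\gamma\circ g=TF_\tau g\circ\beta^w$ (saturations with respect to $f$ and $g$ respectively), such that $(R,p,q)$ is the final span with $f\circ p=g\circ q$. **Theorem.**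 Let $\alpha$ be a $TF_\tau$-coalgebra on $X$, with its corresponding $W$-LTS. 1. Let $X\xleftarrow{p}R\xrightarrow{q}X$ be a jointly monic span whose relation $\{(p(r),q(r))\mid r\in R\}$ on $X$ is reflexive (in particular, one whose relation is an equivalence relation). Then the span is a coalgebraic weak bisimulation between $\alpha$ and $\alpha$ if and only if its relation is a weak $W$-bisimulation of the corresponding $W$-LTS. 2. Consequently, two states are weakly $W$-bisimilar if and only if they are related by a coalgebraic weak bisimulation between $\alpha$ and $\alpha$ whose relation is an equivalence relation. -/

import Mathlib

universe u v w

/-! ### Weights: semirings with countable sums -/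

/-- A (not necessarily commutative) semiring with a sum for every countable family: finite sums are
the given ones, the sum is invariant under re-indexing and under grouping the family along an
arbitrary partition, and multiplication distributes over it on both sides. -/
class OmegaSemiring (W : Type*) extends Semiring W where
  csum : (ℕ → W) → W
  csum_single : ∀ (n : ℕ) (a : W), csum (fun m => if m = n then a else 0) = a
  csum_pair : ∀ a b : W, csum (fun m => if m = 0 then a else if m = 1 then b else 0) = a + b
  csum_partition : ∀ (p : ℕ → ℕ) (f : ℕ → W),
    csum (fun k => csum (fun n => if p n = k then f n else 0)) = csum f
  mul_csum : ∀ (a : W) (f : ℕ → W), a * csum f = csum (fun n => a * f n)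
  csum_mul : ∀ (f : ℕ → W) (a : W), csum f * a = csum (fun n => f n * a)

open Classical in
/-- The sum of a family with at most countably many nonzero members (and `0` otherwise): number the
nonzero members injectively, extend by `0` to a sequence, and sum. -/
noncomputable def wsum {W : Type*} [OmegaSemiring W] {ι : Type*} (f : ι → W) : W :=
  if h : ∃ e : Function.support f → ℕ, Function.Injective e then
    OmegaSemiring.csum (Function.extend h.choose (fun i => f i.1) 0)
  else 0

theorem OmegaSemiring.csum_zero {W : Type*} [OmegaSemiring W] :
    OmegaSemiring.csum (0 : ℕ → W) = 0 := by
  have h := OmegaSemiring.csum_single (W := W) 0 0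
  simp only [ite_self] at h
  exact h

/-- The sum does not depend on the numbering. -/
theorem csum_extend_eq {W : Type*} [OmegaSemiring W] {ι : Type*} (f : ι → W) (e e' : ι → ℕ)
    (he : Function.Injective e) (he' : Function.Injective e') :
    OmegaSemiring.csum (Function.extend e f 0) = OmegaSemiring.csum (Function.extend e' f 0) := by
  rw [← OmegaSemiring.csum_partition (Function.extend e e' 0) (Function.extend e f 0)]
  congr 1
  funext k
  by_cases hk : ∃ i, e' i = k
  · obtain ⟨i, rfl⟩ := hk
    rw [he'.extend_apply, ← OmegaSemiring.csum_single (e i) (f i)]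
    congr 1
    funext n
    by_cases hn : ∃ j, e j = n
    · obtain ⟨j, rfl⟩ := hn
      rw [he.extend_apply e' 0 j, he.extend_apply f 0 j]
      by_cases h : j = i
      · rw [h, if_pos rfl, if_pos rfl]
      · rw [if_neg fun h' => h (he' h'), if_neg fun h' => h (he h')]
    · have h : n ≠ e i := fun h => hn ⟨i, h.symm⟩
      simp [Function.extend_apply' _ _ _ hn, h]
  · rw [Function.extend_apply' _ _ _ hk, Pi.zero_apply]
    refine Eq.trans (congrArg _ (funext fun n => ?_)) OmegaSemiring.csum_zero
    by_cases hn : ∃ j, e j = n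
    · obtain ⟨j, rfl⟩ := hn
      rw [he.extend_apply e' 0 j, if_neg fun h => hk ⟨j, h⟩, Pi.zero_apply]
    · simp [Function.extend_apply' _ _ _ hn]

theorem wsum_eq_csum {W : Type*} [OmegaSemiring W] {ι : Type*} (f : ι → W)
    (e : Function.support f → ℕ) (he : Function.Injective e) :
    wsum f = OmegaSemiring.csum (Function.extend e (fun i => f i.1) 0) := by
  have h : ∃ e : Function.support f → ℕ, Function.Injective e := ⟨e, he⟩
  unfold wsum
  rw [dif_pos h]
  exact csum_extend_eq _ _ _ h.choose_spec he

theorem wsum_eq_zero {W : Type*} [OmegaSemiring W] {ι : Type*} {f : ι → W}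
    (hf : ∀ i, f i = 0) : wsum f = 0 := by
  rw [wsum_eq_csum f (fun _ => 0) fun i => absurd (hf i.1) i.2]
  refine Eq.trans (congrArg _ (funext fun n => ?_)) OmegaSemiring.csum_zero
  exact Function.extend_apply' _ _ _ fun ⟨i, _⟩ => i.2 (hf i.1)

theorem exists_ne_zero_of_wsum_ne_zero {W : Type*} [OmegaSemiring W] {ι : Type*} {f : ι → W}
    (h : wsum f ≠ 0) : ∃ i, f i ≠ 0 := by
  by_contra hc
  exact h (wsum_eq_zero fun i => not_not.mp fun hi => hc ⟨i, hi⟩)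

/-! ### Weighted labelled transition systems and weak bisimulation -/

/-- An image-countable labelled transition system on the states `X` with labels in `L`, weighted
over `W`. -/
@[ext] structure WLTS (W X L : Type*) [Zero W] where
  wt : X → L → X → W
  image_countable : ∀ x a, {y | wt x a y ≠ 0}.Countable

namespace WLTS

variable {W X L : Type*}

/-- A finite sequence of steps `x --a₁--> x₁ --a₂--> ⋯ --aₙ--> xₙ`, kept as its start `x` and the
list `[(a₁, x₁), …, (aₙ, xₙ)]`, is an execution path if every step has nonzero weight. -/
def IsPath [Zero W] (S : WLTS W X L) : X → List (L × X) → Prop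
  | _, [] => True
  | x, (a, y) :: π => S.wt x a y ≠ 0 ∧ S.IsPath y π

/-- The last state of a path. -/
def last : X → List (L × X) → X
  | x, [] => x
  | _, (_, y) :: π => last y π

/-- The trace of a path. -/
def trace (π : List (L × X)) : List L := π.map Prod.fst

/-- The weight of a path: the ordered product of the weights of its steps. -/
def pathWeight [Semiring W] (S : WLTS W X L) : X → List (L × X) → W
  | _, [] => 1
  | x, (a, y) :: π => S.wt x a y * S.pathWeight y π

/-- The execution paths from `x` that end in `C` with trace in `T`, no proper prefix of which
already ends in `C` with trace in `T`. -/
def reachPaths [Zero W] (S : WLTS W X L) (x : X) (T : Language L) (C : Set X) :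
    Set (List (L × X)) :=
  {π | S.IsPath x π ∧ last x π ∈ C ∧ trace π ∈ T ∧
    ∀ π', π' <+: π → π' ≠ π → trace π' ∈ T → last x π' ∉ C}

/-- The total weight with which `x` reaches `C` along the traces in `T`. -/
noncomputable def reachWeight [OmegaSemiring W] (S : WLTS W X L) (x : X) (T : Language L)
    (C : Set X) : W :=
  wsum fun π : S.reachPaths x T C => S.pathWeight x π.1

end WLTS

/-- The traces `τ*`; the labels are `A + {τ}`, with `none` in the role of the silent `τ`. -/
def tauStar (A : Type*) : Language (Option A) :=
  KStar.kstar ({[none]} : Language (Option A))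

/-- The traces `τ* a τ*`. -/
def tauStarObs {A : Type*} (a : A) : Language (Option A) :=
  tauStar A * ({[some a]} : Language (Option A)) * tauStar A

/-- Weak bisimulations of a weighted labelled transition system with silent action. -/
structure WLTS.IsWeakBisimulation {W X A : Type*} [OmegaSemiring W] (S : WLTS W X (Option A))
    (r : X → X → Prop) : Prop where
  equiv : Equivalence r
  obs : ∀ x x', r x x' → ∀ a : A, ∀ C ∈ (Setoid.mk r equiv).classes,
    S.reachWeight x (tauStarObs a) C = S.reachWeight x' (tauStarObs a) C
  silent : ∀ x x', r x x' → ∀ C ∈ (Setoid.mk r equiv).classes,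
    S.reachWeight x (tauStar A) C = S.reachWeight x' (tauStar A) C

/-- Two states are weakly bisimilar if some weak bisimulation relates them. -/
def WLTS.WeakBisimilar {W X A : Type*} [OmegaSemiring W] (S : WLTS W X (Option A))
    (x x' : X) : Prop :=
  ∃ r, S.IsWeakBisimulation r ∧ r x x'

/-! ### The monad of countably supported weight functions -/

/-- The functions `X → W` with at most countable support. -/
def FW (W X : Type*) [Zero W] : Type _ := {φ : X → W // (Function.support φ).Countable}

namespace FW

variable {W X Y A : Type*}

/-- The pointwise order. -/
instance [Zero W] [PartialOrder W] : PartialOrder (FW W X) :=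
  PartialOrder.lift (fun φ : FW W X => φ.1) Subtype.val_injective

variable [OmegaSemiring W]

/-- The functor action: sum along the fibres. -/
noncomputable def map (g : X → Y) (φ : FW W X) : FW W Y :=
  ⟨fun y => wsum fun x : {x // g x = y} => φ.1 x.1, by
    refine (φ.2.image g).mono fun y hy => ?_
    obtain ⟨x, hx⟩ := exists_ne_zero_of_wsum_ne_zero hy
    exact ⟨x.1, hx, x.2⟩⟩

open Classical in
/-- The unit `η` of the monad. -/
noncomputable def unit (x : X) : FW W X :=
  ⟨fun y => if y = x then 1 else 0, by
    refine (Set.countable_singleton x).mono fun y hy => ?_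
    by_contra h
    exact hy (if_neg h)⟩

/-- The multiplication `μ` of the monad. -/
noncomputable def mult (ψ : FW W (FW W X)) : FW W X :=
  ⟨fun x => wsum fun φ : FW W X => ψ.1 φ * φ.1 x, by
    refine (ψ.2.biUnion fun φ _ => φ.2).mono fun x hx => ?_
    obtain ⟨φ, hφ⟩ := exists_ne_zero_of_wsum_ne_zero hx
    exact Set.mem_biUnion (left_ne_zero_of_mul hφ) (right_ne_zero_of_mul hφ)⟩

/-- Composition in the Kleisli category: first `f`, then `g`. -/
noncomputable def kcomp {Z : Type*} (g : Y → FW W Z) (f : X → FW W Y) (x : X) : FW W Z :=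
  mult (map g (f x))

open Classical in
/-- The distributive law `A × T X → T (A × X)`. -/
noncomputable def dist (u : A × FW W X) : FW W (A × X) :=
  ⟨fun v => if v.1 = u.1 then u.2.1 v.2 else 0, by
    refine (u.2.2.image (Prod.mk u.1)).mono fun v hv => ?_
    have h : v.1 = u.1 := by
      by_contra h
      exact hv (if_neg h)
    refine ⟨v.2, fun h0 => hv ?_, ?_⟩
    · simp only [if_pos h]
      exact h0
    · rw [← h]⟩

/-! ### Traces and iterates -/

/-- The final coalgebra, on `ℕ · B = ℕ × B`, of the lifting of `- + B` to the Kleisli category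
(there composed with the unit). -/
def finalStr {B : Type*} : ℕ × B → (ℕ × B) ⊕ B
  | (0, b) => Sum.inr b
  | (n + 1, b) => Sum.inl (n, b)

/-- The lifting of `- + B` to the Kleisli category, on arrows. -/
noncomputable def liftPlus {B : Type*} (t : X → FW W Y) : X ⊕ B → FW W (Y ⊕ B) :=
  Sum.elim (fun x => map Sum.inl (t x)) (fun b => unit (Sum.inr b))

/-- `t` is the trace map of `α`: the arrow of coalgebras, in the Kleisli category, from `α` to the
final coalgebra. -/
def IsTrace {B : Type*} (α : X → FW W (X ⊕ B)) (t : X → FW W (ℕ × B)) : Prop :=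
  kcomp (liftPlus t) α = map finalStr ∘ t

/-- `i` is the iterate of `α`: its trace map followed by the codiagonal `ℕ · B → B`. -/
def IsIterate {B : Type*} (α : X → FW W (X ⊕ B)) (i : X → FW W B) : Prop :=
  ∃ t, IsTrace α t ∧ i = map Prod.snd ∘ t

end FW

/-! ### Weak saturation -/

/-- `TF_τ`-coalgebras, for `T = FW W`, `F = A × -` and `F_τ X = X + F X`. -/
abbrev TFCoalg (W X A : Type*) [Zero W] : Type _ := X → FW W (X ⊕ (A × X))

section Saturation

variable {W X A C : Type*} [OmegaSemiring W] [PartialOrder W]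

/-- `αs` and `αo` are the silent and the observable part of `α`: the greatest arrows whose join,
after the coproduct injections, is `α`. -/
def IsParts (α : TFCoalg W X A) (αs : X → FW W X) (αo : X → FW W (A × X)) : Prop :=
  IsGreatest {u : (X → FW W X) × (X → FW W (A × X)) |
    IsLUB {FW.map Sum.inl ∘ u.1, FW.map Sum.inr ∘ u.2} α} (αs, αo)

open Classical in
/-- The splitting of `X` into the states outside and inside the class `c` of `f`. -/
noncomputable def classSplit (f : X → C) (c : C) (x : X) : {x // f x ≠ c} ⊕ {x // f x = c} :=
  if h : f x = c then Sum.inr ⟨x, h⟩ else Sum.inl ⟨x, h⟩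

/-- The restriction of `αs` to the states outside the class `c`, those inside `c` being taken as
the observables. -/
noncomputable def classCoalg (αs : X → FW W X) (f : X → C) (c : C) :
    {x // f x ≠ c} → FW W ({x // f x ≠ c} ⊕ {x // f x = c}) :=
  fun x => FW.map (classSplit f c) (αs x.1)

/-- `ατ` describes how each state reaches each class of `f` by silent actions only. It is the join
of the unit with the arrow `αp` collecting, for each state `x`, the iterates for the classes that
do not contain `x`. -/
def IsTauReach (α : TFCoalg W X A) (f : X → C) (ατ : X → FW W X) : Prop :=
  ∃ (αs : X → FW W X) (αo : X → FW W (A × X))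
    (it : ∀ c : C, {x // f x ≠ c} → FW W {x // f x = c}) (αp : X → FW W X),
    IsParts α αs αo ∧
    (∀ c, FW.IsIterate (classCoalg αs f c) (it c)) ∧
    (∀ x, IsLUB {φ | ∃ (c : C) (h : f x ≠ c), φ = FW.map Subtype.val (it c ⟨x, h⟩)} (αp x)) ∧
    IsLUB {FW.unit, αp} ατ

/-- The composite `X → TFX → TFTX → TTFX → TFX` of `i`, `TF ατ`, the distributive law and the
multiplication. -/
noncomputable def flat (i : X → FW W (A × X)) (ατ : X → FW W X) : X → FW W (A × X) :=
  fun x => FW.mult (FW.map FW.dist (FW.map (Prod.map id ατ) (i x)))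

/-- `αw` is the weak saturation of `α` with respect to `f`. -/
def IsWeakSaturation (α : TFCoalg W X A) (f : X → C) (αw : TFCoalg W X A) : Prop :=
  ∃ (ατ : X → FW W X) (i : X → FW W (A × X)),
    IsTauReach α f ατ ∧ FW.IsIterate α i ∧
    IsLUB {FW.map Sum.inl ∘ ατ, FW.map Sum.inr ∘ flat i ατ} αw

end Saturation

/-! ### Coalgebraic weak bisimulations -/

/-- The functor `TF_τ` on arrows. -/
noncomputable def TFCoalg.fmap {W X Y A : Type*} [OmegaSemiring W] (f : X → Y) :
    FW W (X ⊕ (A × X)) → FW W (Y ⊕ (A × Y)) :=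
  FW.map (Sum.map f (Prod.map id f))

/-- `p` and `q` are jointly monic. -/
def JointlyMonic {R X Y : Type*} (p : R → X) (q : R → Y) : Prop :=
  Function.Injective fun r => (p r, q r)

/-- `f` and `g` are jointly epic. -/
def JointlyEpic {X Y C : Type*} (f : X → C) (g : Y → C) : Prop :=
  ∀ c, (∃ x, f x = c) ∨ ∃ y, g y = c

/-- `(R, p, q)` is final among the spans that make the square with `f` and `g` commute. -/
def IsFinalSpan {R X Y C : Type u} (p : R → X) (q : R → Y) (f : X → C) (g : Y → C) : Prop :=
  f ∘ p = g ∘ q ∧ ∀ (Z : Type u) (a : Z → X) (b : Z → Y), f ∘ a = g ∘ b →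
    ∃! h : Z → R, p ∘ h = a ∧ q ∘ h = b

/-- The jointly monic span `(R, p, q)` is a weak bisimulation between the `TF_τ`-coalgebras `α` and
`β`: it is the final span over an epic cospan `(f, g)` that is a cocongruence of the weak
saturations of `α` with respect to `f` and of `β` with respect to `g`. -/
def IsCoalgWeakBisimulation {W : Type w} {A : Type v} {X Y R : Type u} [OmegaSemiring W]
    [PartialOrder W] (α : TFCoalg W X A) (β : TFCoalg W Y A) (p : R → X) (q : R → Y) : Prop :=
  JointlyMonic p q ∧
  ∃ (C : Type u) (f : X → C) (g : Y → C) (αw : TFCoalg W X A) (βw : TFCoalg W Y A)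
    (γ : TFCoalg W C A),
    JointlyEpic f g ∧ IsWeakSaturation α f αw ∧ IsWeakSaturation β g βw ∧
    γ ∘ f = TFCoalg.fmap f ∘ αw ∧ γ ∘ g = TFCoalg.fmap g ∘ βw ∧
    IsFinalSpan p q f g

/-- The relation described by a span. -/
def spanRel {R X Y : Type*} (p : R → X) (q : R → Y) (x : X) (y : Y) : Prop :=
  ∃ r, p r = x ∧ q r = y

/-- The one-to-one correspondence between `TF_τ`-coalgebras and image-countable weighted labelled
transition systems with labels `A + {τ}`. -/
def coalgEquivWLTS (W X A : Type*) [Zero W] [Countable A] :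
    TFCoalg W X A ≃ WLTS W X (Option A) where
  toFun α :=
    { wt := fun x l y => l.elim ((α x).1 (Sum.inl y)) fun a => (α x).1 (Sum.inr (a, y))
      image_countable := fun x l => by
        cases l with
        | none => exact (α x).2.preimage Sum.inl_injective
        | some a =>
          exact (α x).2.preimage (f := fun y => Sum.inr (a, y)) fun y z h => by simpa using h }
  invFun S := fun x =>
    ⟨Sum.elim (fun y => S.wt x none y) (fun u => S.wt x (some u.1) u.2), by
      refine (((S.image_countable x none).image Sum.inl).union
        (Set.countable_iUnion fun a : A =>
          (S.image_countable x (some a)).image fun y => Sum.inr (a, y))).mono ?_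
      rintro (y | ⟨a, y⟩) h
      · exact Or.inl ⟨y, h, rfl⟩
      · exact Or.inr (Set.mem_iUnion.2 ⟨a, y, h, rfl⟩)⟩
  left_inv α := by
    funext x
    apply Subtype.ext
    funext z
    rcases z with y | ⟨a, y⟩ <;> rfl
  right_inv S := by
    ext x l y
    cases l <;> rfl

/-! ### Countable sums -/

section Wsum

variable {W ι κ : Type*} [OmegaSemiring W]

/-! The weak saturation exists, is unique, and pushed forward along `f` it is exactly the table of
weights that weak bisimulation compares.

Existence and uniqueness: all joins in its definition are joins of weight functions with disjoint
supports (the two summands, or distinct classes). In the canonical order `0` is least, so such a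
join is just the function pieced together from its members (`FW.isLUB_of_attained`). Traces are
unique because the homomorphism equation is a recursion on the number of steps (`FW.isTrace_iff`).
Together these give `isWeakSaturation_iff`.

Identification of the weights: `FW.wsum_iterate_mul` evaluates an iterate against a test function by
means of any sequence obeying the first-step recursion. Path sums obey it: minimal `τ*` sequences
graded by length, minimal `τ* a τ*` sequences graded by their leading silent steps. In the second
case minimality is void before the first observable step and means first entry along `τ*` after it,
which matches the composite of the unrestricted iterate with `ατ`. Hence `map_tauReach_apply` and
`map_flat_apply`.

So for surjective `f` a suitable `γ` exists iff states identified by `f` have equal reaching weights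
(`exists_descent_weakSaturation_iff`). Reflexivity of the relation forces the two legs of the cospan
to coincide, so the common leg is surjective with the relation as its kernel; conversely a weak
bisimulation is the kernel of its quotient map. -/

theorem wsum_eq_zero_of_not_countable {f : ι → W} (h : ¬ (Function.support f).Countable) :
    wsum f = 0 := by
  unfold wsum
  rw [dif_neg]
  rintro ⟨e, he⟩
  exact h (Set.countable_coe_iff.1 he.countable)

/-- Any numbering of a set that contains the support may be used to compute the sum. -/
theorem wsum_eq_csum_of_support_subset (f : ι → W) (s : Set ι) (hs : Function.support f ⊆ s)
    (e : s → ℕ) (he : Function.Injective e) :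
    wsum f = OmegaSemiring.csum (Function.extend e (fun i => f i.1) 0) := by
  rw [wsum_eq_csum f (fun i => e ⟨i.1, hs i.2⟩)
    fun i j h => Subtype.ext (congrArg (fun i : s => i.1) (he h))]
  congr 1
  funext n
  by_cases hn : ∃ i : s, e i = n
  · obtain ⟨i, rfl⟩ := hn
    rw [he.extend_apply]
    by_cases hi : f i.1 = 0
    · rw [hi, Function.extend_apply', Pi.zero_apply]
      rintro ⟨j, hj⟩
      exact j.2 ((congrArg (fun i : s => f i.1) (he hj)).trans hi)
    · exact Function.Injective.extend_apply (f := fun j : Function.support f => e ⟨j.1, hs j.2⟩)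
        (fun i j h => Subtype.ext (congrArg (fun i : s => i.1) (he h))) _ _ ⟨i.1, hi⟩
  · rw [Function.extend_apply' _ _ _ hn, Function.extend_apply']
    rintro ⟨j, hj⟩
    exact hn ⟨_, hj⟩

theorem wsum_comp_of_injective {j : ι → κ} (hj : Function.Injective j) (f : κ → W)
    (hf : ∀ k, f k ≠ 0 → k ∈ Set.range j) : wsum (fun i => f (j i)) = wsum f := by
  by_cases hc : (Function.support f).Countable
  · obtain ⟨e, he⟩ := hc.to_subtype.exists_injective_nat
    have he' : Function.Injective
        fun i : Function.support (fun i => f (j i)) => e ⟨j i.1, i.2⟩ :=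
      fun i i' h => Subtype.ext (hj (congrArg Subtype.val (he h)))
    rw [wsum_eq_csum f e he, wsum_eq_csum _ _ he']
    congr 1
    funext n
    by_cases hn : ∃ k, e k = n
    · obtain ⟨⟨k, hk⟩, rfl⟩ := hn
      obtain ⟨i, rfl⟩ := hf k hk
      rw [he.extend_apply]
      exact he'.extend_apply _ _ ⟨i, hk⟩
    · rw [Function.extend_apply' _ _ _ hn, Function.extend_apply']
      rintro ⟨i, hi⟩
      exact hn ⟨_, hi⟩
  -- Both supports are uncountable, so both sums take the default value `0`; no countability
  -- hypothesis is needed.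
  · rw [wsum_eq_zero_of_not_countable hc, wsum_eq_zero_of_not_countable]
    intro h
    refine hc ((h.image j).mono fun k hk => ?_)
    obtain ⟨i, rfl⟩ := hf k hk
    exact ⟨i, hk, rfl⟩

theorem wsum_eq_single (f : ι → W) (i : ι) (h : ∀ j, j ≠ i → f j = 0) : wsum f = f i := by
  have hs : Function.support f ⊆ {i} := fun j hj => by
    by_contra hne
    exact hj (h j hne)
  have he : Function.Injective (fun _ : ({i} : Set ι) => (0 : ℕ)) :=
    fun a b _ => Subtype.ext (a.2.trans b.2.symm)
  rw [wsum_eq_csum_of_support_subset f {i} hs (fun _ => 0) he]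
  refine Eq.trans (congrArg _ (funext fun n => ?_)) (OmegaSemiring.csum_single 0 (f i))
  by_cases hn : n = 0
  · subst hn
    rw [if_pos rfl]
    exact he.extend_apply _ _ ⟨i, rfl⟩
  · rw [if_neg hn, Function.extend_apply', Pi.zero_apply]
    rintro ⟨_, h⟩
    exact hn h.symm

/-- Summation along the fibres of a map. -/
theorem wsum_fiberwise (p : ι → κ) (f : ι → W) (hf : (Function.support f).Countable) :
    wsum (fun k => wsum fun i : {i // p i = k} => f i.1) = wsum f := by
  obtain ⟨e, he⟩ := hf.to_subtype.exists_injective_nat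
  obtain ⟨d, hd⟩ := (hf.image p).to_subtype.exists_injective_nat
  have hs : Function.support (fun k => wsum fun i : {i // p i = k} => f i.1) ⊆
      p '' Function.support f := fun k hk => by
    obtain ⟨i, hi⟩ := exists_ne_zero_of_wsum_ne_zero hk
    exact ⟨i.1, hi, i.2⟩
  -- The partition of `ℕ` induced by `p` through the numberings `e` and `d`. Indices outside the
  -- range of `e` land in block `0`, harmlessly, since the extended family vanishes there.
  let q : ℕ → ℕ := Function.extend e (fun i => d ⟨p i.1, i.1, i.2, rfl⟩) 0
  have hq : ∀ i, q (e i) = d ⟨p i.1, i.1, i.2, rfl⟩ := fun i => he.extend_apply _ _ i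
  rw [wsum_eq_csum_of_support_subset _ _ hs d hd, wsum_eq_csum f e he,
    ← OmegaSemiring.csum_partition q (Function.extend e _ 0)]
  congr 1
  funext m
  by_cases hm : ∃ k, d k = m
  · obtain ⟨k, rfl⟩ := hm
    rw [hd.extend_apply]
    have he' : Function.Injective
        fun i : Function.support (fun i : {i // p i = k.1} => f i.1) => e ⟨i.1.1, i.2⟩ :=
      fun i i' h => Subtype.ext (Subtype.ext (congrArg (fun i : Function.support f => i.1) (he h)))
    rw [wsum_eq_csum _ _ he']
    congr 1
    funext n
    by_cases hn : ∃ i, e i = n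
    · obtain ⟨i, rfl⟩ := hn
      rw [he.extend_apply, hq]
      by_cases hi : p i.1 = k.1
      · rw [if_pos (congrArg d (Subtype.ext hi))]
        exact he'.extend_apply _ _ ⟨⟨i.1, hi⟩, i.2⟩
      · rw [if_neg fun h => hi (congrArg Subtype.val (hd h)), Function.extend_apply',
          Pi.zero_apply]
        rintro ⟨j, hj⟩
        exact hi ((congrArg (fun i : Function.support f => p i.1) (he hj)).symm.trans j.1.2)
    · rw [Function.extend_apply' _ _ _ hn, Function.extend_apply', Pi.zero_apply, ite_self]
      rintro ⟨j, hj⟩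
      exact hn ⟨_, hj⟩
  · rw [Function.extend_apply' _ _ _ hm, Pi.zero_apply]
    refine (Eq.trans (congrArg _ (funext fun n => ?_)) OmegaSemiring.csum_zero).symm
    by_cases hn : ∃ i, e i = n
    · obtain ⟨i, rfl⟩ := hn
      rw [hq, if_neg fun h => hm ⟨_, h⟩, Pi.zero_apply]
    · rw [Function.extend_apply' _ _ _ hn, Pi.zero_apply, ite_self]

/-- Countability matters: over an uncountable support the left side is `0` by default, while
multiplication by `a` may cut the support down to a countable one. -/
theorem mul_wsum (a : W) (f : ι → W) (hf : (Function.support f).Countable) :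
    a * wsum f = wsum fun i => a * f i := by
  obtain ⟨e, he⟩ := hf.to_subtype.exists_injective_nat
  rw [wsum_eq_csum f e he, OmegaSemiring.mul_csum,
    wsum_eq_csum_of_support_subset (fun i => a * f i) (Function.support f)
      (fun i hi => right_ne_zero_of_mul hi) e he]
  congr 1
  funext n
  by_cases hn : ∃ i, e i = n
  · obtain ⟨i, rfl⟩ := hn
    rw [he.extend_apply, he.extend_apply]
  · rw [Function.extend_apply' _ _ _ hn, Function.extend_apply' _ _ _ hn, Pi.zero_apply, mul_zero]

theorem wsum_mul (f : ι → W) (hf : (Function.support f).Countable) (a : W) :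
    wsum f * a = wsum fun i => f i * a := by
  obtain ⟨e, he⟩ := hf.to_subtype.exists_injective_nat
  rw [wsum_eq_csum f e he, OmegaSemiring.csum_mul,
    wsum_eq_csum_of_support_subset (fun i => f i * a) (Function.support f)
      (fun i hi => left_ne_zero_of_mul hi) e he]
  congr 1
  funext n
  by_cases hn : ∃ i, e i = n
  · obtain ⟨i, rfl⟩ := hn
    rw [he.extend_apply, he.extend_apply]
  · rw [Function.extend_apply' _ _ _ hn, Function.extend_apply' _ _ _ hn, Pi.zero_apply, zero_mul]

theorem wsum_prod (f : ι × κ → W) (hf : (Function.support f).Countable) :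
    wsum (fun i => wsum fun k => f (i, k)) = wsum f := by
  rw [← wsum_fiberwise Prod.fst f hf]
  congr 1
  funext i
  refine wsum_comp_of_injective (j := fun k => (⟨(i, k), rfl⟩ : {v : ι × κ // v.1 = i}))
    (fun k k' h => congrArg (fun v : {v : ι × κ // v.1 = i} => v.1.2) h) (fun v => f v.1) ?_
  rintro ⟨⟨_, k⟩, rfl⟩ _
  exact ⟨k, rfl⟩

theorem wsum_comm (f : ι → κ → W) (hf : (Function.support fun v : ι × κ => f v.1 v.2).Countable) :
    wsum (fun i => wsum fun k => f i k) = wsum fun k => wsum fun i => f i k := by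
  rw [wsum_prod (fun v : ι × κ => f v.1 v.2) hf]
  have h : (Function.support fun v : κ × ι => f v.2 v.1).Countable :=
    hf.preimage (f := Prod.swap) Prod.swap_injective
  rw [wsum_prod (fun v : κ × ι => f v.2 v.1) h]
  exact (wsum_comp_of_injective Prod.swap_injective (fun v : ι × κ => f v.1 v.2)
    fun v _ => ⟨v.swap, v.swap_swap⟩).symm

theorem wsum_subtype (s : Set ι) (f : ι → W) :
    wsum (fun i : s => f i.1) = wsum (s.indicator f) := by
  rw [← wsum_comp_of_injective (j := fun i : s => i.1) Subtype.val_injective (s.indicator f)]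
  · congr 1
    funext i
    rw [Set.indicator_of_mem i.2]
  · intro i hi
    rw [Subtype.range_coe]
    by_contra h
    exact hi (Set.indicator_of_notMem h f)

/-- Supplies the joint countability that `wsum_comm` asks for when sums in Kleisli composites are
exchanged. -/
theorem countable_support_mul_of_countable {f : ι → W} (hf : (Function.support f).Countable)
    (g : ι → κ → W) (hg : ∀ i, (Function.support (g i)).Countable) :
    (Function.support fun v : ι × κ => f v.1 * g v.1 v.2).Countable := by
  refine (hf.biUnion fun i _ => (hg i).image (Prod.mk i)).mono ?_
  rintro ⟨i, k⟩ h
  exact Set.mem_biUnion (left_ne_zero_of_mul h) ⟨k, right_ne_zero_of_mul h, rfl⟩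

end Wsum

/-! ### Countably supported weight functions -/

namespace FW

variable {W X Y Z B A : Type*} [OmegaSemiring W]

theorem ext_apply {φ ψ : FW W X} (h : ∀ x, φ.1 x = ψ.1 x) : φ = ψ :=
  Subtype.ext (funext h)

theorem map_apply_of_injective {g : X → Y} (hg : Function.Injective g) (φ : FW W X) (x : X) :
    (map g φ).1 (g x) = φ.1 x :=
  wsum_eq_single (fun z : {z // g z = g x} => φ.1 z.1) ⟨x, rfl⟩
    fun z hz => absurd (Subtype.ext (hg z.2)) hz

theorem map_apply_of_notMem_range {g : X → Y} (φ : FW W X) {y : Y} (hy : ∀ x, g x ≠ y) :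
    (map g φ).1 y = 0 :=
  wsum_eq_zero fun x => absurd x.2 (hy x.1)

@[simp] theorem map_inl_apply_inl (φ : FW W X) (x : X) :
    (map (Sum.inl : X → X ⊕ Y) φ).1 (Sum.inl x) = φ.1 x :=
  map_apply_of_injective Sum.inl_injective φ x

@[simp] theorem map_inl_apply_inr (φ : FW W X) (y : Y) :
    (map (Sum.inl : X → X ⊕ Y) φ).1 (Sum.inr y) = 0 :=
  map_apply_of_notMem_range φ fun _ => Sum.inl_ne_inr

@[simp] theorem map_inr_apply_inr (φ : FW W Y) (y : Y) :
    (map (Sum.inr : Y → X ⊕ Y) φ).1 (Sum.inr y) = φ.1 y :=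
  map_apply_of_injective Sum.inr_injective φ y

@[simp] theorem map_inr_apply_inl (φ : FW W Y) (x : X) :
    (map (Sum.inr : Y → X ⊕ Y) φ).1 (Sum.inl x) = 0 :=
  map_apply_of_notMem_range φ fun _ => Sum.inr_ne_inl

theorem unit_apply_self (x : X) : (unit x : FW W X).1 x = 1 :=
  if_pos rfl

theorem unit_apply_of_ne {x y : X} (h : y ≠ x) : (unit x : FW W X).1 y = 0 :=
  if_neg h

/-- Change of variables. -/
theorem wsum_map (g : X → Y) (φ : FW W X) (h : Y → W) :
    (wsum fun y => (map g φ).1 y * h y) = wsum fun x => φ.1 x * h (g x) := by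
  rw [← wsum_fiberwise g _ (φ.2.mono fun x hx => left_ne_zero_of_mul hx)]
  congr 1
  funext y
  have hc : (Function.support fun x : {x // g x = y} => φ.1 x.1).Countable :=
    φ.2.preimage (f := Subtype.val) Subtype.val_injective
  refine (wsum_mul _ hc (h y)).trans ?_
  congr 1
  funext x
  rw [x.2]

/-- Change of variables removes the sum over the type of all weight functions, so that Kleisli
composition becomes a matrix product. -/
theorem mult_map_apply (g : Y → FW W Z) (φ : FW W Y) (z : Z) :
    (mult (map g φ)).1 z = wsum fun y => φ.1 y * (g y).1 z :=
  wsum_map g φ fun χ => χ.1 z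

theorem kcomp_apply (g : Y → FW W Z) (f : X → FW W Y) (x : X) (z : Z) :
    (kcomp g f x).1 z = wsum fun y => (f x).1 y * (g y).1 z :=
  mult_map_apply g (f x) z

theorem map_kcomp {V : Type*} (h : Z → V) (g : Y → FW W Z) (f : X → FW W Y) (x : X) :
    map h (kcomp g f x) = kcomp (map h ∘ g) f x := by
  refine ext_apply fun v => ?_
  rw [kcomp_apply]
  have hc := countable_support_mul_of_countable (f x).2
    (fun (y : Y) (z : {z // h z = v}) => (g y).1 z.1)
    fun y => (g y).2.preimage (f := Subtype.val) Subtype.val_injective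
  calc (map h (kcomp g f x)).1 v
      = wsum fun z : {z // h z = v} => wsum fun y => (f x).1 y * (g y).1 z.1 := by
        change wsum _ = _
        congr 1
        funext z
        exact kcomp_apply g f x z.1
    _ = wsum fun y => wsum fun z : {z // h z = v} => (f x).1 y * (g y).1 z.1 :=
        (wsum_comm _ hc).symm
    _ = _ := by
        congr 1
        funext y
        exact (mul_wsum _ _ ((g y).2.preimage (f := Subtype.val) Subtype.val_injective)).symm

/-! ### Parts of weight functions on a coproduct -/

/-- The restriction to the left summand. -/
def left (φ : FW W (X ⊕ Y)) : FW W X :=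
  ⟨fun x => φ.1 (Sum.inl x), φ.2.preimage Sum.inl_injective⟩

/-- The restriction to the right summand. -/
def right (φ : FW W (X ⊕ Y)) : FW W Y :=
  ⟨fun y => φ.1 (Sum.inr y), φ.2.preimage Sum.inr_injective⟩

/-- The weight function on a coproduct with the given restrictions. -/
def copair (φ : FW W X) (ψ : FW W Y) : FW W (X ⊕ Y) :=
  ⟨Sum.elim φ.1 ψ.1, by
    refine ((φ.2.image Sum.inl).union (ψ.2.image Sum.inr)).mono ?_
    rintro (x | y) h
    · exact Or.inl ⟨x, h, rfl⟩
    · exact Or.inr ⟨y, h, rfl⟩⟩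

theorem copair_left_right (φ : FW W (X ⊕ Y)) : copair (left φ) (right φ) = φ := by
  refine ext_apply ?_
  rintro (x | y) <;> rfl

theorem map_copair_inl {X' Y' : Type*} (g : X → X') (h : Y → Y') (φ : FW W X) (ψ : FW W Y)
    (x : X') : (map (Sum.map g h) (copair φ ψ)).1 (Sum.inl x) = (map g φ).1 x := by
  refine (wsum_comp_of_injective
    (j := fun z : {z // g z = x} =>
      (⟨Sum.inl z.1, congrArg Sum.inl z.2⟩ : {v // Sum.map g h v = Sum.inl x}))
    (fun z z' e => Subtype.ext (Sum.inl_injective (congrArg Subtype.val e)))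
    (fun v => (copair φ ψ).1 v.1) ?_).symm
  rintro ⟨z | z, hz⟩ _
  · exact ⟨⟨z, Sum.inl_injective hz⟩, rfl⟩
  · exact absurd hz Sum.inr_ne_inl

theorem map_copair_inr {X' Y' : Type*} (g : X → X') (h : Y → Y') (φ : FW W X) (ψ : FW W Y)
    (y : Y') : (map (Sum.map g h) (copair φ ψ)).1 (Sum.inr y) = (map h ψ).1 y := by
  refine (wsum_comp_of_injective
    (j := fun z : {z // h z = y} =>
      (⟨Sum.inr z.1, congrArg Sum.inr z.2⟩ : {v // Sum.map g h v = Sum.inr y}))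
    (fun z z' e => Subtype.ext (Sum.inr_injective (congrArg Subtype.val e)))
    (fun v => (copair φ ψ).1 v.1) ?_).symm
  rintro ⟨z | z, hz⟩ _
  · exact absurd hz Sum.inl_ne_inr
  · exact ⟨⟨z, Sum.inr_injective hz⟩, rfl⟩

/-! ### Existence and uniqueness of traces and iterates -/

/-- The weights of the runs that take `n` further steps and then leave to `B`. -/
noncomputable def traceStep (α : X → FW W (X ⊕ B)) : ℕ → X → FW W B
  | 0 => right ∘ α
  | n + 1 => kcomp (traceStep α n) (left ∘ α)

/-- The trace map. -/
noncomputable def traceMap (α : X → FW W (X ⊕ B)) (x : X) : FW W (ℕ × B) :=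
  ⟨fun v => (traceStep α v.1 x).1 v.2, by
    refine (Set.countable_iUnion fun n => (traceStep α n x).2.image (Prod.mk n)).mono ?_
    rintro ⟨n, b⟩ h
    exact Set.mem_iUnion.2 ⟨n, b, h, rfl⟩⟩

/-- Being bijective, the final structure map lets an equation of functions on `(ℕ × B) ⊕ B` be
tested at the images of `(0, b)` and `(n + 1, b)`. -/
theorem finalStr_bijective : Function.Bijective (finalStr : ℕ × B → (ℕ × B) ⊕ B) := by
  constructor
  · rintro ⟨_ | n, b⟩ ⟨_ | m, c⟩ h <;> simp_all [finalStr]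
  · rintro (⟨n, b⟩ | b)
    · exact ⟨(n + 1, b), rfl⟩
    · exact ⟨(0, b), rfl⟩

theorem kcomp_liftPlus_inr (t : X → FW W Y) (α : X → FW W (X ⊕ B)) (x : X) (b : B) :
    (kcomp (liftPlus t) α x).1 (Sum.inr b) = (α x).1 (Sum.inr b) := by
  rw [kcomp_apply, wsum_eq_single _ (Sum.inr b)]
  · simp [liftPlus, unit_apply_self]
  · rintro (y | c) h
    · simp [liftPlus]
    · have hne : (Sum.inr b : Y ⊕ B) ≠ Sum.inr c := fun e => h (by rw [Sum.inr_injective e])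
      simp [liftPlus, unit_apply_of_ne (W := W) hne]

theorem kcomp_liftPlus_inl (t : X → FW W Y) (α : X → FW W (X ⊕ B)) (x : X) (y : Y) :
    (kcomp (liftPlus t) α x).1 (Sum.inl y) = (kcomp t (left ∘ α) x).1 y := by
  rw [kcomp_apply, kcomp_apply, ← wsum_comp_of_injective (j := Sum.inl) Sum.inl_injective]
  · simp [liftPlus, left]
  · rintro (z | c) h
    · exact ⟨z, rfl⟩
    · refine absurd ?_ h
      simp [liftPlus, unit_apply_of_ne (W := W) (Sum.inl_ne_inr (a := y) (b := c))]

/-- Read in coordinates, the homomorphism equation says that level `0` of `t` is the observable part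
of `α` and that level `n + 1` is one internal step followed by level `n`. This recursion has exactly
one solution. -/
theorem isTrace_iff {α : X → FW W (X ⊕ B)} {t : X → FW W (ℕ × B)} :
    IsTrace α t ↔ t = traceMap α := by
  have key : IsTrace α t ↔ ∀ x, (∀ b, (α x).1 (Sum.inr b) = (t x).1 (0, b)) ∧
      ∀ n b, (kcomp t (left ∘ α) x).1 (n, b) = (t x).1 (n + 1, b) := by
    constructor
    · intro h x
      refine ⟨fun b => ?_, fun n b => ?_⟩
      · rw [← kcomp_liftPlus_inr t α x b, h]
        exact map_apply_of_injective finalStr_bijective.1 (t x) (0, b)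
      · rw [← kcomp_liftPlus_inl, h]
        exact map_apply_of_injective finalStr_bijective.1 (t x) (n + 1, b)
    · refine fun h => funext fun x => ext_apply fun v => ?_
      obtain ⟨⟨_ | n, b⟩, rfl⟩ := finalStr_bijective.2 v
      · exact (kcomp_liftPlus_inr t α x b).trans (((h x).1 b).trans
          (map_apply_of_injective finalStr_bijective.1 (t x) (0, b)).symm)
      · exact (kcomp_liftPlus_inl t α x (n, b)).trans (((h x).2 n b).trans
          (map_apply_of_injective finalStr_bijective.1 (t x) (n + 1, b)).symm)
  rw [key]
  constructor
  · refine fun h => funext fun x => ext_apply ?_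
    rintro ⟨n, b⟩
    induction n generalizing x with
    | zero => exact ((h x).1 b).symm
    | succ n ih =>
      rw [← (h x).2, kcomp_apply]
      refine Eq.trans ?_ (kcomp_apply (traceStep α n) (left ∘ α) x b).symm
      congr 1
      funext y
      rw [ih y]
      rfl
  · rintro rfl x
    refine ⟨fun b => rfl, fun n b => ?_⟩
    rw [kcomp_apply]
    exact (kcomp_apply (traceStep α n) (left ∘ α) x b).symm

/-- The iterate. -/
noncomputable def iterate (α : X → FW W (X ⊕ B)) : X → FW W B :=
  map Prod.snd ∘ traceMap α

theorem isIterate_iff {α : X → FW W (X ⊕ B)} {i : X → FW W B} :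
    IsIterate α i ↔ i = iterate α := by
  simp [IsIterate, isTrace_iff, iterate]

/-- The weight of an observation `h` after the iterate is the sum of any sequence that satisfies the
first-step recursion for `h`. -/
theorem wsum_iterate_mul (α : X → FW W (X ⊕ B)) (h : B → W) (G : ℕ → X → W)
    (h0 : ∀ x, G 0 x = wsum fun b => (α x).1 (Sum.inr b) * h b)
    (hs : ∀ n x, G (n + 1) x = wsum fun y => (α x).1 (Sum.inl y) * G n y) (x : X) :
    (wsum fun b => (iterate α x).1 b * h b) = wsum fun n => G n x := by
  -- Each level of the trace, tested against `h`, obeys the same recursion as `G`; the inductive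
  -- step is associativity of the matrix product.
  have hG : ∀ n x, (wsum fun b => (traceStep α n x).1 b * h b) = G n x := by
    intro n
    induction n with
    | zero => exact fun x => (h0 x).symm
    | succ n ih =>
      intro x
      rw [hs]
      have hc := countable_support_mul_of_countable (left (α x)).2
        (fun y b => (traceStep α n y).1 b * h b)
        fun y => (traceStep α n y).2.mono fun b hb => left_ne_zero_of_mul hb
      calc (wsum fun b => (traceStep α (n + 1) x).1 b * h b)
          = wsum fun b => wsum fun y =>
              (left (α x)).1 y * ((traceStep α n y).1 b * h b) := by
            congr 1
            funext b
            rw [traceStep, kcomp_apply, wsum_mul]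
            · simp [mul_assoc]
            · exact (left (α x)).2.mono fun y hy => left_ne_zero_of_mul hy
        _ = wsum fun y => wsum fun b =>
              (left (α x)).1 y * ((traceStep α n y).1 b * h b) := (wsum_comm _ hc).symm
        _ = _ := by
            congr 1
            funext y
            rw [← ih, mul_wsum]
            · rfl
            · exact (traceStep α n y).2.mono fun b hb => left_ne_zero_of_mul hb
  refine (wsum_map Prod.snd (traceMap α x) h).trans ?_
  rw [← wsum_prod _ ((traceMap α x).2.mono fun v hv => left_ne_zero_of_mul hv)]
  congr 1
  funext n
  exact hG n x

end FW

/-! ### Path weights -/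

namespace WLTS

variable {W X L : Type*}

section Countable

variable [Semiring W]

/-- The converse can fail because of zero divisors, but this direction suffices to drop the path
condition from sums of weights. -/
theorem isPath_of_pathWeight_ne_zero (S : WLTS W X L) {x : X} {π : List (L × X)}
    (h : S.pathWeight x π ≠ 0) : S.IsPath x π := by
  induction π generalizing x with
  | nil => trivial
  | cons s π ih => exact ⟨left_ne_zero_of_mul h, ih (right_ne_zero_of_mul h)⟩

theorem countable_setOf_wt_ne_zero [Countable L] (S : WLTS W X L) (x : X) :
    {s : L × X | S.wt x s.1 s.2 ≠ 0}.Countable := by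
  refine (Set.countable_iUnion fun a : L => (S.image_countable x a).image (Prod.mk a)).mono ?_
  rintro ⟨a, y⟩ h
  exact Set.mem_iUnion.2 ⟨a, y, h, rfl⟩

/-- Induction on the length: countably many labels and image-countability leave countably many first
steps. -/
theorem countable_setOf_isPath [Countable L] (S : WLTS W X L) (x : X) :
    {π | S.IsPath x π}.Countable := by
  have h : ∀ n x, {π | S.IsPath x π ∧ π.length = n}.Countable := by
    intro n
    induction n with
    | zero =>
      intro x
      refine (Set.countable_singleton []).mono fun π hπ => ?_
      exact List.length_eq_zero_iff.1 hπ.2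
    | succ n ih =>
      intro x
      refine ((S.countable_setOf_wt_ne_zero x).biUnion
        fun s _ => (ih s.2).image (List.cons s)).mono ?_
      rintro (_ | ⟨s, π⟩) ⟨hπ, hn⟩
      · cases hn
      · exact Set.mem_biUnion (x := s) hπ.1 ⟨π, ⟨hπ.2, Nat.succ_injective hn⟩, rfl⟩
  refine (Set.countable_iUnion fun n => h n x).mono fun π hπ => ?_
  exact Set.mem_iUnion.2 ⟨π.length, hπ, rfl⟩

theorem countable_support_pathWeight [Countable L] (S : WLTS W X L) (x : X) :
    (Function.support (S.pathWeight x)).Countable :=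
  (S.countable_setOf_isPath x).mono fun _ h => S.isPath_of_pathWeight_ne_zero h

end Countable

variable [OmegaSemiring W]

/-- The total weight of the paths from `x` in the set `Q`. -/
noncomputable def pathSum (S : WLTS W X L) (x : X) (Q : Set (List (L × X))) : W :=
  wsum (Q.indicator (S.pathWeight x))

theorem countable_support_indicator_pathWeight [Countable L] (S : WLTS W X L) (x : X)
    (Q : Set (List (L × X))) : (Function.support (Q.indicator (S.pathWeight x))).Countable := by
  refine (S.countable_support_pathWeight x).mono ?_
  rw [Set.support_indicator]
  exact Set.inter_subset_right

/-- Paths are summed along a grading. -/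
theorem wsum_pathSum [Countable L] (S : WLTS W X L) (x : X) (Q : Set (List (L × X)))
    (d : List (L × X) → ℕ) :
    (wsum fun n => S.pathSum x {π | π ∈ Q ∧ d π = n}) = S.pathSum x Q := by
  unfold pathSum
  rw [← wsum_fiberwise d _ (S.countable_support_indicator_pathWeight x Q)]
  congr 1
  funext n
  refine Eq.trans ?_ (wsum_subtype {π | d π = n} (Q.indicator (S.pathWeight x))).symm
  rw [Set.indicator_indicator]
  congr 2
  ext π
  exact and_comm

/-- First-step decomposition. -/
theorem pathSum_eq_wsum_step [Countable L] (S : WLTS W X L) (x : X) (Q : Set (List (L × X)))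
    (hQ : [] ∉ Q) :
    S.pathSum x Q = wsum fun s : L × X => S.wt x s.1 s.2 * S.pathSum s.2 {π | s :: π ∈ Q} := by
  have hinj : Function.Injective fun v : (L × X) × List (L × X) => v.1 :: v.2 := by
    rintro ⟨s, π⟩ ⟨s', π'⟩ h
    exact Prod.ext (List.cons.inj h).1 (List.cons.inj h).2
  have hrange : ∀ π, Q.indicator (S.pathWeight x) π ≠ 0 →
      π ∈ Set.range fun v : (L × X) × List (L × X) => v.1 :: v.2 := by
    rintro (_ | ⟨s, π⟩) h
    · exact absurd (Set.indicator_of_notMem hQ _) h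
    · exact ⟨(s, π), rfl⟩
  unfold pathSum
  rw [← wsum_comp_of_injective hinj _ hrange, ← wsum_prod]
  · congr 1
    funext s
    rw [mul_wsum _ _ (S.countable_support_indicator_pathWeight s.2 _)]
    congr 1
    funext π
    by_cases h : s :: π ∈ Q
    · rw [Set.indicator_of_mem h, Set.indicator_of_mem (show π ∈ {π | s :: π ∈ Q} from h)]
      rfl
    · rw [Set.indicator_of_notMem h, Set.indicator_of_notMem (show π ∉ {π | s :: π ∈ Q} from h),
        mul_zero]
  · exact (S.countable_support_indicator_pathWeight x Q).preimage hinj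

theorem pathSum_empty (S : WLTS W X L) (x : X) : S.pathSum x ∅ = 0 :=
  wsum_eq_zero fun π => Set.indicator_of_notMem (Set.notMem_empty π) _

theorem pathSum_singleton_nil (S : WLTS W X L) (x : X) : S.pathSum x {[]} = 1 := by
  unfold pathSum
  rw [wsum_eq_single _ [] fun π hπ => Set.indicator_of_notMem (s := {[]}) hπ _,
    Set.indicator_of_mem (Set.mem_singleton _)]
  rfl

/-- The sequences of steps from `x` that end in `C` with trace in `T`, no proper prefix of which
does. -/
def reachSeqs (x : X) (T : Language L) (C : Set X) : Set (List (L × X)) :=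
  {π | last x π ∈ C ∧ trace π ∈ T ∧
    ∀ π', π' <+: π → π' ≠ π → trace π' ∈ T → last x π' ∉ C}

/-- A sequence that is not a path has weight `0`, so it may be included. What remains is a condition
on sequences alone, which behaves well under removing the first step. -/
theorem reachWeight_eq_pathSum (S : WLTS W X L) (x : X) (T : Language L) (C : Set X) :
    S.reachWeight x T C = S.pathSum x (reachSeqs x T C) := by
  refine (wsum_subtype (S.reachPaths x T C) (S.pathWeight x)).trans ?_
  unfold pathSum
  congr 1
  funext π
  by_cases hp : S.IsPath x π
  · by_cases hπ : π ∈ reachSeqs x T C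
    · rw [Set.indicator_of_mem hπ, Set.indicator_of_mem (show π ∈ S.reachPaths x T C from ⟨hp, hπ⟩)]
    · rw [Set.indicator_of_notMem hπ, Set.indicator_of_notMem fun h => hπ h.2]
  · rw [Set.indicator_apply_eq_zero.2 fun _ => ?_, Set.indicator_apply_eq_zero.2 fun _ => ?_] <;>
    exact not_not.1 fun h => hp (S.isPath_of_pathWeight_ne_zero h)

theorem nil_mem_reachSeqs {x : X} {T : Language L} {C : Set X} :
    [] ∈ reachSeqs x T C ↔ x ∈ C ∧ [] ∈ T := by
  refine ⟨fun h => ⟨h.1, h.2.1⟩, fun h => ⟨h.1, h.2, fun π' h' hne => ?_⟩⟩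
  exact absurd (List.prefix_nil.1 h') hne

/-- Removing the first step turns the language into its left quotient. Only the empty prefix is
lost, and it accounts for the extra condition on `x`. -/
theorem cons_mem_reachSeqs {x : X} {T : Language L} {C : Set X} {s : L × X} {π : List (L × X)} :
    s :: π ∈ reachSeqs x T C ↔
      (x ∈ C → [] ∉ T) ∧ π ∈ reachSeqs s.2 (T.leftQuotient [s.1]) C := by
  constructor
  · rintro ⟨hC, hT, hp⟩
    refine ⟨fun hx hnil => hp [] List.nil_prefix (by simp) hnil hx, hC, hT, ?_⟩
    intro π' h' hne hT'
    exact hp (s :: π') (List.cons_prefix_cons.2 ⟨rfl, h'⟩) (by simpa using hne) hT'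
  · rintro ⟨h0, hC, hT, hp⟩
    refine ⟨hC, hT, ?_⟩
    rintro (_ | ⟨s', π'⟩) h' hne hT'
    · exact fun hx => h0 hx hT'
    · obtain ⟨rfl, h''⟩ := List.cons_prefix_cons.1 h'
      exact hp π' h'' (by simpa using hne) hT'

end WLTS

/-! ### The traces `τ*` and `τ* a τ*` -/

section Traces

variable {A : Type*}

theorem nil_mem_tauStar : [] ∈ tauStar A := Language.nil_mem_kstar _

theorem mem_tauStar_iff {w : List (Option A)} : w ∈ tauStar A ↔ ∀ l ∈ w, l = none := by
  unfold tauStar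
  rw [Language.mem_kstar]
  constructor
  · rintro ⟨S, rfl, hS⟩ l hl
    obtain ⟨y, hy, hly⟩ := List.mem_flatten.1 hl
    have : y = [none] := hS y hy
    subst this
    simpa using hly
  · intro h
    refine ⟨w.map fun l => [l], ?_, ?_⟩
    · induction w with
      | nil => rfl
      | cons l w ih => simpa using ih fun k hk => h k (List.mem_cons_of_mem _ hk)
    · intro y hy
      obtain ⟨l, hl, rfl⟩ := List.mem_map.1 hy
      rw [h l hl]
      exact Set.mem_singleton _

/-- The left quotients here and below describe a deterministic automaton with states `τ* a τ*`, `τ*`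
and the empty language; its transitions drive the first-step recursions. -/
theorem tauStar_leftQuotient_none : (tauStar A).leftQuotient [none] = tauStar A := by
  ext w
  rw [Language.mem_leftQuotient, mem_tauStar_iff, mem_tauStar_iff]
  simp

theorem tauStar_leftQuotient_some (a : A) : (tauStar A).leftQuotient [some a] = 0 := by
  ext w
  rw [Language.mem_leftQuotient, mem_tauStar_iff]
  simp [Language.notMem_zero]

theorem mem_tauStarObs_iff {a : A} {w : List (Option A)} :
    w ∈ tauStarObs a ↔ ∃ u ∈ tauStar A, ∃ v ∈ tauStar A, w = u ++ some a :: v := by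
  unfold tauStarObs
  rw [Language.mem_mul]
  constructor
  · rintro ⟨_, h, v, hv, rfl⟩
    obtain ⟨u, hu, _, rfl, rfl⟩ := Language.mem_mul.1 h
    exact ⟨u, hu, v, hv, by simp⟩
  · rintro ⟨u, hu, v, hv, rfl⟩
    exact ⟨u ++ [some a], Language.mem_mul.2 ⟨u, hu, [some a], rfl, rfl⟩, v, hv, by simp⟩

theorem nil_notMem_tauStarObs (a : A) : [] ∉ tauStarObs a := by
  simp [mem_tauStarObs_iff]

theorem tauStarObs_leftQuotient_none (a : A) :
    (tauStarObs a).leftQuotient [none] = tauStarObs a := by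
  ext w
  rw [Language.mem_leftQuotient, List.singleton_append, mem_tauStarObs_iff, mem_tauStarObs_iff]
  constructor
  · rintro ⟨_ | ⟨l, u⟩, hu, v, hv, h⟩
    · simp at h
    · rw [List.cons_append, List.cons.injEq] at h
      refine ⟨u, ?_, v, hv, h.2⟩
      rw [mem_tauStar_iff] at hu ⊢
      exact fun k hk => hu k (List.mem_cons_of_mem _ hk)
  · rintro ⟨u, hu, v, hv, rfl⟩
    refine ⟨none :: u, ?_, v, hv, rfl⟩
    rw [mem_tauStar_iff] at hu ⊢
    simpa using hu

theorem tauStarObs_leftQuotient_some_self (a : A) :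
    (tauStarObs a).leftQuotient [some a] = tauStar A := by
  ext w
  rw [Language.mem_leftQuotient, List.singleton_append, mem_tauStarObs_iff]
  constructor
  · rintro ⟨_ | ⟨l, u⟩, hu, v, hv, h⟩
    · exact (List.cons.inj h).2 ▸ hv
    · have hl := mem_tauStar_iff.1 hu l List.mem_cons_self
      exact absurd ((List.cons.inj h).1.trans hl) (Option.some_ne_none a)
  · exact fun hw => ⟨[], nil_mem_tauStar, w, hw, rfl⟩

theorem tauStarObs_leftQuotient_some_of_ne {a b : A} (hb : b ≠ a) :
    (tauStarObs a).leftQuotient [some b] = 0 := by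
  ext w
  rw [Language.mem_leftQuotient, List.singleton_append, mem_tauStarObs_iff]
  refine iff_of_false ?_ (Language.notMem_zero w)
  rintro ⟨_ | ⟨l, u⟩, hu, v, hv, h⟩
  · exact hb (Option.some_injective _ (List.cons.inj h).1)
  · have hl := mem_tauStar_iff.1 hu l List.mem_cons_self
    exact absurd ((List.cons.inj h).1.trans hl) (Option.some_ne_none b)

end Traces

/-! ### First-step recursions for the reaching weights -/

namespace WLTS

variable {W X A : Type*} [OmegaSemiring W]

theorem reachSeqs_zero {L : Type*} (x : X) (C : Set X) :
    reachSeqs x (0 : Language L) C = ∅ :=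
  Set.eq_empty_of_forall_notMem fun _ h => Language.notMem_zero _ h.2.1

/-- The empty sequence already ends in `C` with trace in `τ*`, so nothing longer is minimal. -/
theorem reachSeqs_tauStar_of_mem {x : X} {C : Set X} (hx : x ∈ C) :
    reachSeqs x (tauStar A) C = {[]} := by
  ext π
  cases π with
  | nil => exact iff_of_true (nil_mem_reachSeqs.2 ⟨hx, nil_mem_tauStar⟩) rfl
  | cons s π =>
    refine iff_of_false (fun h => ?_) (List.cons_ne_nil s π)
    exact (cons_mem_reachSeqs.1 h).1 hx nil_mem_tauStar

theorem reachWeight_tauStar_of_mem (S : WLTS W X (Option A)) {x : X} {C : Set X} (hx : x ∈ C) :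
    S.reachWeight x (tauStar A) C = 1 := by
  rw [reachWeight_eq_pathSum, reachSeqs_tauStar_of_mem hx, pathSum_singleton_nil]

variable [Countable A] (S : WLTS W X (Option A))

/-- This is the recursion of `FW.traceStep`. From outside `C` the empty prefix imposes nothing, and
an observable first step leaves the empty language. -/
theorem pathSum_tauStar_length_succ {x : X} {C : Set X} (hx : x ∉ C) (n : ℕ) :
    S.pathSum x {π | π ∈ reachSeqs x (tauStar A) C ∧ π.length = n + 1} =
      wsum fun y => S.wt x none y *
        S.pathSum y {π | π ∈ reachSeqs y (tauStar A) C ∧ π.length = n} := by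
  rw [pathSum_eq_wsum_step _ _ _ fun h => hx (nil_mem_reachSeqs.1 h.1).1]
  have hj : Function.Injective fun y : X => ((none : Option A), y) := Prod.mk_right_injective _
  rw [← wsum_comp_of_injective hj]
  · congr 1
    funext y
    congr 2
    ext π
    simp only [Set.mem_ofPred_eq, cons_mem_reachSeqs, tauStar_leftQuotient_none, List.length_cons,
      Nat.succ_inj]
    exact ⟨fun h => ⟨h.1.2, h.2⟩, fun h => ⟨⟨fun h' => absurd h' hx, h.1⟩, h.2⟩⟩
  · rintro ⟨_ | a, y⟩ h
    · exact ⟨y, rfl⟩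
    · refine absurd ?_ h
      have he : {π | (some a, y) :: π ∈ {π | π ∈ reachSeqs x (tauStar A) C ∧ π.length = n + 1}} =
          ∅ := by
        refine Set.eq_empty_of_forall_notMem fun π hπ => ?_
        have := (cons_mem_reachSeqs.1 hπ.1).2
        rw [tauStar_leftQuotient_some, reachSeqs_zero] at this
        exact this
      simp only [he, pathSum_empty, mul_zero]

theorem wsum_pathSum_tauStar {x : X} {C : Set X} (hx : x ∉ C) :
    (wsum fun n => S.pathSum x {π | π ∈ reachSeqs x (tauStar A) C ∧ π.length = n + 1}) =
      S.reachWeight x (tauStar A) C := by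
  -- From outside `C` no admissible sequence is empty, so the truncated `length - 1` is a faithful
  -- grading.
  rw [reachWeight_eq_pathSum,
    ← S.wsum_pathSum x (reachSeqs x (tauStar A) C) fun π => π.length - 1]
  congr 1
  funext n
  congr 1
  ext π
  refine and_congr_right fun h => ?_
  cases π with
  | nil => exact absurd (nil_mem_reachSeqs.1 h).1 hx
  | cons s π => simp

/-- The number of leading silent steps. -/
def leadingSilent (π : List (Option A × X)) : ℕ :=
  (π.takeWhile fun s => s.1.isNone).length

/-- The first step must be `a`, after which minimality is first entry into `C` along `τ*`. Whether
`x` lies in `C` is irrelevant, as the empty trace is not in `τ* a τ*`. -/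
theorem pathSum_tauStarObs_leadingSilent_zero (a : A) (x : X) (C : Set X) :
    S.pathSum x {π | π ∈ reachSeqs x (tauStarObs a) C ∧ leadingSilent π = 0} =
      wsum fun v : A × X => S.wt x (some v.1) v.2 *
        ({a} : Set A).indicator (fun _ => S.reachWeight v.2 (tauStar A) C) v.1 := by
  rw [pathSum_eq_wsum_step _ _ _
    fun h => nil_notMem_tauStarObs a (nil_mem_reachSeqs.1 h.1).2]
  have hj : Function.Injective fun v : A × X => (some v.1, v.2) := fun v v' h => by
    simpa [Prod.ext_iff] using h
  rw [← wsum_comp_of_injective hj]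
  · congr 1
    funext v
    obtain ⟨b, y⟩ := v
    congr 1
    by_cases hb : b = a
    · subst hb
      rw [Set.indicator_of_mem (Set.mem_singleton _), reachWeight_eq_pathSum]
      congr 1
      ext π
      simp [cons_mem_reachSeqs, tauStarObs_leftQuotient_some_self, leadingSilent,
        nil_notMem_tauStarObs]
    · rw [Set.indicator_of_notMem (s := {a}) hb, ← S.pathSum_empty y]
      congr 1
      refine Set.eq_empty_of_forall_notMem fun π hπ => ?_
      have := (cons_mem_reachSeqs.1 hπ.1).2
      rw [tauStarObs_leftQuotient_some_of_ne hb, reachSeqs_zero] at this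
      exact this
  · rintro ⟨_ | b, y⟩ h
    · refine absurd ?_ h
      have he : {π | ((none : Option A), y) :: π ∈
          {π | π ∈ reachSeqs x (tauStarObs a) C ∧ leadingSilent π = 0}} = ∅ := by
        refine Set.eq_empty_of_forall_notMem fun π hπ => ?_
        simpa [leadingSilent] using hπ.2
      simp only [he, pathSum_empty, mul_zero]
    · exact ⟨(b, y), rfl⟩

theorem pathSum_tauStarObs_leadingSilent_succ (a : A) (x : X) (C : Set X) (n : ℕ) :
    S.pathSum x {π | π ∈ reachSeqs x (tauStarObs a) C ∧ leadingSilent π = n + 1} =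
      wsum fun y => S.wt x none y *
        S.pathSum y {π | π ∈ reachSeqs y (tauStarObs a) C ∧ leadingSilent π = n} := by
  rw [pathSum_eq_wsum_step _ _ _
    fun h => nil_notMem_tauStarObs a (nil_mem_reachSeqs.1 h.1).2]
  have hj : Function.Injective fun y : X => ((none : Option A), y) := Prod.mk_right_injective _
  rw [← wsum_comp_of_injective hj]
  · congr 1
    funext y
    congr 2
    ext π
    simp [cons_mem_reachSeqs, tauStarObs_leftQuotient_none, leadingSilent, nil_notMem_tauStarObs]
  · rintro ⟨_ | b, y⟩ h
    · exact ⟨y, rfl⟩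
    · refine absurd ?_ h
      have he : {π | (some b, y) :: π ∈
          {π | π ∈ reachSeqs x (tauStarObs a) C ∧ leadingSilent π = n + 1}} = ∅ := by
        refine Set.eq_empty_of_forall_notMem fun π hπ => ?_
        simpa [leadingSilent] using hπ.2
      simp only [he, pathSum_empty, mul_zero]

end WLTS

/-! ### Iterates as reaching weights -/

section Iterates

variable {W X A C : Type*} [OmegaSemiring W] (α : TFCoalg W X A) (f : X → C)

theorem classSplit_apply_of_eq {c : C} {x : X} (h : f x = c) :
    classSplit f c x = Sum.inr ⟨x, h⟩ := dif_pos h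

theorem classSplit_apply_of_ne {c : C} {x : X} (h : f x ≠ c) :
    classSplit f c x = Sum.inl ⟨x, h⟩ := dif_neg h

theorem classSplit_injective (c : C) : Function.Injective (classSplit f c) := by
  intro x y h
  by_cases hx : f x = c <;> by_cases hy : f y = c
  · rw [classSplit_apply_of_eq f hx, classSplit_apply_of_eq f hy] at h
    exact congrArg Subtype.val (Sum.inr_injective h)
  · rw [classSplit_apply_of_eq f hx, classSplit_apply_of_ne f hy] at h
    exact absurd h Sum.inr_ne_inl
  · rw [classSplit_apply_of_ne f hx, classSplit_apply_of_eq f hy] at h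
    exact absurd h Sum.inl_ne_inr
  · rw [classSplit_apply_of_ne f hx, classSplit_apply_of_ne f hy] at h
    exact congrArg Subtype.val (Sum.inl_injective h)

theorem classCoalg_apply_inl (αs : X → FW W X) (c : C) (x y : {x // f x ≠ c}) :
    (classCoalg αs f c x).1 (Sum.inl y) = (αs x.1).1 y.1 := by
  rw [← classSplit_apply_of_ne f y.2]
  exact FW.map_apply_of_injective (classSplit_injective f c) _ _

theorem classCoalg_apply_inr (αs : X → FW W X) (c : C) (x : {x // f x ≠ c}) (y : {x // f x = c}) :
    (classCoalg αs f c x).1 (Sum.inr y) = (αs x.1).1 y.1 := by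
  rw [← classSplit_apply_of_eq f y.2]
  exact FW.map_apply_of_injective (classSplit_injective f c) _ _

variable [Countable A]

theorem wsum_iterate_classCoalg (c : C) (x : {x // f x ≠ c}) :
    wsum (FW.iterate (classCoalg (FW.left ∘ α) f c) x).1 =
      (coalgEquivWLTS W X A α).reachWeight x.1 (tauStar A) (f ⁻¹' {c}) := by
  set S := coalgEquivWLTS W X A α
  -- The test function `1` totals the weight over the class. Level `n` means `n` steps outside the
  -- class and then one into it, hence length `n + 1`.
  have key := FW.wsum_iterate_mul (classCoalg (FW.left ∘ α) f c) (fun _ => 1)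
    (fun n x => S.pathSum x.1
      {π | π ∈ WLTS.reachSeqs x.1 (tauStar A) (f ⁻¹' {c}) ∧ π.length = n + 1}) ?_ ?_ x
  · simp only [mul_one] at key
    rw [← S.wsum_pathSum_tauStar (C := f ⁻¹' {c}) x.2]
    exact key
  · intro x
    rw [S.pathSum_tauStar_length_succ (C := f ⁻¹' {c}) x.2 0,
      ← wsum_comp_of_injective (j := fun y : {x // f x = c} => y.1) Subtype.val_injective]
    · congr 1
      funext y
      rw [classCoalg_apply_inr, WLTS.reachSeqs_tauStar_of_mem (C := f ⁻¹' {c}) y.2,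
        show {π : List (Option A × X) | π ∈ ({[]} : Set _) ∧ π.length = 0} = {[]} by
          ext π; simp, S.pathSum_singleton_nil]
      rfl
    -- A successor outside the class does not reach it in zero steps.
    · intro y hy
      by_contra hr
      have hc : y ∉ f ⁻¹' {c} := fun h => hr ⟨⟨y, h⟩, rfl⟩
      refine hy ?_
      have he : {π | π ∈ WLTS.reachSeqs y (tauStar A) (f ⁻¹' {c}) ∧ π.length = 0} = ∅ := by
        refine Set.eq_empty_of_forall_notMem fun π hπ => hc ?_
        have h := hπ.1
        rw [List.length_eq_zero_iff.1 hπ.2] at h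
        exact (WLTS.nil_mem_reachSeqs.1 h).1
      rw [he, S.pathSum_empty, mul_zero]
  · intro n x
    rw [S.pathSum_tauStar_length_succ (C := f ⁻¹' {c}) x.2 (n + 1),
      ← wsum_comp_of_injective (j := fun y : {x // f x ≠ c} => y.1) Subtype.val_injective]
    · congr 1
      funext y
      rw [classCoalg_apply_inl]
      rfl
    -- A successor inside the class admits only the empty sequence, hence none of length `n + 1`.
    · intro y hy
      by_contra hr
      have hc : y ∈ f ⁻¹' {c} := not_not.1 fun h => hr ⟨⟨y, h⟩, rfl⟩
      refine hy ?_
      have he : {π | π ∈ WLTS.reachSeqs y (tauStar A) (f ⁻¹' {c}) ∧ π.length = n + 1} = ∅ := by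
        refine Set.eq_empty_of_forall_notMem fun π hπ => ?_
        have h := hπ.1
        rw [WLTS.reachSeqs_tauStar_of_mem (C := f ⁻¹' {c}) hc] at h
        have h' := hπ.2
        rw [Set.mem_singleton_iff.1 h] at h'
        simp at h'
      rw [he, S.pathSum_empty, mul_zero]

/-- The iterate weighs arbitrary silent runs up to the first observable step; the test function
selects the label `a` and charges the remaining first entry into `D`. -/
theorem wsum_iterate_mul_reachWeight (a : A) (D : Set X) (x : X) :
    (wsum fun v : A × X => (FW.iterate α x).1 v * ({a} : Set A).indicator
        (fun _ => (coalgEquivWLTS W X A α).reachWeight v.2 (tauStar A) D) v.1) =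
      (coalgEquivWLTS W X A α).reachWeight x (tauStarObs a) D := by
  set S := coalgEquivWLTS W X A α
  rw [WLTS.reachWeight_eq_pathSum, ← S.wsum_pathSum x _ WLTS.leadingSilent]
  refine FW.wsum_iterate_mul α
    (fun v => ({a} : Set A).indicator (fun _ => S.reachWeight v.2 (tauStar A) D) v.1)
    (fun n x => S.pathSum x
      {π | π ∈ WLTS.reachSeqs x (tauStarObs a) D ∧ WLTS.leadingSilent π = n}) ?_ ?_ x
  · exact fun x => S.pathSum_tauStarObs_leadingSilent_zero a x D
  · exact fun n x => S.pathSum_tauStarObs_leadingSilent_succ a x D n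

/-- The states that the iterate for a class reaches are ends of execution paths. -/
theorem exists_isPath_of_iterate_classCoalg_ne_zero {c : C} {x : {x // f x ≠ c}}
    {y : {x // f x = c}} (h : (FW.iterate (classCoalg (FW.left ∘ α) f c) x).1 y ≠ 0) :
    ∃ π, (coalgEquivWLTS W X A α).IsPath x.1 π ∧ WLTS.last x.1 π = y.1 := by
  obtain ⟨⟨⟨n, _⟩, rfl⟩, hn⟩ := exists_ne_zero_of_wsum_ne_zero h
  rename_i y
  change (FW.traceStep (classCoalg (FW.left ∘ α) f c) n x).1 y ≠ 0 at hn
  clear h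
  induction n generalizing x with
  | zero =>
    refine ⟨[(none, y.1)], ⟨?_, trivial⟩, rfl⟩
    rw [show (coalgEquivWLTS W X A α).wt x.1 none y.1 = ((FW.left ∘ α) x.1).1 y.1 from rfl,
      ← classCoalg_apply_inr f]
    exact hn
  | succ n ih =>
    rw [FW.traceStep, FW.kcomp_apply] at hn
    obtain ⟨z, hz⟩ := exists_ne_zero_of_wsum_ne_zero hn
    obtain ⟨π, hπ, hl⟩ := ih (right_ne_zero_of_mul hz)
    refine ⟨(none, z.1) :: π, ⟨?_, hπ⟩, hl⟩
    rw [show (coalgEquivWLTS W X A α).wt x.1 none z.1 = ((FW.left ∘ α) x.1).1 z.1 from rfl,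
      ← classCoalg_apply_inl f]
    exact left_ne_zero_of_mul hz

end Iterates

/-! ### Least upper bounds of weight functions -/

namespace FW

variable {W Y I : Type*} [OmegaSemiring W] [PartialOrder W] [CanonicallyOrderedAdd W]

/-- Where the bound is nonzero it is the value of a member, and where it is `0` it lies below
everything. Addition is never compared with joins. -/
theorem isLUB_of_attained {s : Set (FW W Y)} {χ : FW W Y} (hub : ∀ φ ∈ s, ∀ y, φ.1 y ≤ χ.1 y)
    (hatt : ∀ y, χ.1 y = 0 ∨ ∃ φ ∈ s, φ.1 y = χ.1 y) : IsLUB s χ := by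
  refine ⟨hub, fun θ hθ y => ?_⟩
  rcases hatt y with h | ⟨φ, hφ, h⟩
  · exact h.trans_le zero_le
  · exact h.symm.trans_le (hθ hφ y)

theorem isLUB_pair_of_disjoint {u v χ : I → FW W Y}
    (h : ∀ i y, (u i).1 y = (χ i).1 y ∧ (v i).1 y = 0 ∨ (u i).1 y = 0 ∧ (v i).1 y = (χ i).1 y) :
    IsLUB {u, v} χ := by
  refine isLUB_pi.2 fun i => isLUB_of_attained ?_ fun y => ?_
  · rintro _ ⟨_, rfl | rfl, rfl⟩ y
    · rcases h i y with ⟨h, -⟩ | ⟨h, -⟩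
      · exact h.le
      · exact h.trans_le zero_le
    · rcases h i y with ⟨-, h⟩ | ⟨-, h⟩
      · exact h.trans_le zero_le
      · exact h.le
  · rcases h i y with ⟨h, -⟩ | ⟨-, h⟩
    · exact Or.inr ⟨_, ⟨u, Or.inl rfl, rfl⟩, h⟩
    · exact Or.inr ⟨_, ⟨v, Or.inr rfl, rfl⟩, h⟩

theorem isLUB_map_inl_map_inr {X : Type*} (φ : I → FW W X) (ψ : I → FW W Y) :
    IsLUB {map Sum.inl ∘ φ, map Sum.inr ∘ ψ} fun i => copair (φ i) (ψ i) := by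
  refine isLUB_pair_of_disjoint fun i y => ?_
  rcases y with x | y
  · exact Or.inl ⟨map_inl_apply_inl _ _, map_inr_apply_inl _ _⟩
  · exact Or.inr ⟨map_inl_apply_inr _ _, map_inr_apply_inr _ _⟩

theorem isLUB_map_inl_map_inr_iff {X : Type*} {φ : I → FW W X} {ψ : I → FW W Y}
    {χ : I → FW W (X ⊕ Y)} :
    IsLUB {map Sum.inl ∘ φ, map Sum.inr ∘ ψ} χ ↔ χ = fun i => copair (φ i) (ψ i) :=
  ⟨fun h => h.unique (isLUB_map_inl_map_inr φ ψ), fun h => h ▸ isLUB_map_inl_map_inr φ ψ⟩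

end FW

/-! ### Existence and uniqueness of the weak saturation -/

section Saturation

variable {W X A C : Type*} [OmegaSemiring W]

theorem FW.map_val_apply {p : X → Prop} (φ : FW W {x // p x}) (y : {x // p x}) :
    (FW.map Subtype.val φ).1 y.1 = φ.1 y :=
  FW.map_apply_of_injective Subtype.val_injective φ y

theorem FW.map_val_apply_of_not {p : X → Prop} (φ : FW W {x // p x}) {y : X} (h : ¬ p y) :
    (FW.map Subtype.val φ).1 y = 0 :=
  FW.map_apply_of_notMem_range φ fun x hx => h (hx ▸ x.2)

open Classical in
/-- The join of the iterates for the classes that do not contain the given state. -/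
noncomputable def plusReach [Countable A] (α : TFCoalg W X A) (f : X → C) (x : X) : FW W X :=
  ⟨fun y => if h : f x ≠ f y then
      (FW.iterate (classCoalg (FW.left ∘ α) f (f y)) ⟨x, h⟩).1 ⟨y, rfl⟩ else 0, by
    -- There may be uncountably many classes, but every point of the support ends an execution path
    -- from `x`, and those are countably many.
    refine (((coalgEquivWLTS W X A α).countable_setOf_isPath x).image (WLTS.last x)).mono ?_
    intro y hy
    by_cases h : f x ≠ f y
    · refine exists_isPath_of_iterate_classCoalg_ne_zero α f (c := f y) (x := ⟨x, h⟩)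
        (y := ⟨y, rfl⟩) ?_
      simpa only [Function.mem_support, dif_pos h] using hy
    · exact absurd (dif_neg h) hy⟩

open Classical in
/-- How each state reaches each class by silent actions. -/
noncomputable def tauReach [Countable A] (α : TFCoalg W X A) (f : X → C) (x : X) : FW W X :=
  ⟨fun y => if f x = f y then (FW.unit x : FW W X).1 y else (plusReach α f x).1 y, by
    refine ((FW.unit x : FW W X).2.union (plusReach α f x).2).mono fun y hy => ?_
    by_cases h : f x = f y
    · exact Or.inl fun (h0 : (FW.unit x : FW W X).1 y = 0) => hy ((if_pos h).trans h0)
    · exact Or.inr fun (h0 : (plusReach α f x).1 y = 0) => hy ((if_neg h).trans h0)⟩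

/-- Two changes of variables absorb the two functor actions, leaving a single sum over `A × X`. -/
theorem flat_eq_kcomp (i : X → FW W (A × X)) (ατ : X → FW W X) :
    flat i ατ = FW.kcomp (FW.dist ∘ Prod.map id ατ) i := by
  refine funext fun x => FW.ext_apply fun v => ?_
  rw [FW.kcomp_apply]
  refine (FW.mult_map_apply FW.dist _ v).trans ?_
  exact FW.wsum_map (Prod.map id ατ) (i x) fun u => (FW.dist u).1 v

theorem map_dist_apply (f : X → C) (u : A × FW W X) (a : A) (c : C) :
    (FW.map (Prod.map id f) (FW.dist u)).1 (a, c) =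
      ({a} : Set A).indicator (fun _ => (FW.map f u.2).1 c) u.1 := by
  by_cases ha : u.1 = a
  · rw [Set.indicator_of_mem (s := {a}) ha]
    refine (Eq.trans ?_ (wsum_comp_of_injective (j := fun y : {y // f y = c} =>
      (⟨(a, y.1), Prod.ext rfl y.2⟩ : {v : A × X // Prod.map id f v = (a, c)})) ?_ _ ?_)).symm
    · change wsum _ = _
      congr 1
      funext y
      exact (if_pos ha.symm).symm
    · intro y y' h
      exact Subtype.ext (congrArg (fun v : {v : A × X // Prod.map id f v = (a, c)} => v.1.2) h)
    · rintro ⟨⟨b, y⟩, hv⟩ _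
      obtain ⟨rfl, hy⟩ := Prod.ext_iff.1 hv
      exact ⟨⟨y, hy⟩, rfl⟩
  · rw [Set.indicator_of_notMem (s := {a}) ha]
    refine wsum_eq_zero fun v => if_neg fun h => ha ?_
    rw [← h]
    exact congrArg Prod.fst v.2

/-- The summands are disjoint, so exactly one pair has join `α` and the maximality demanded of the
parts is automatic. -/
theorem isParts_iff [PartialOrder W] [CanonicallyOrderedAdd W] (α : TFCoalg W X A)
    {αs : X → FW W X} {αo : X → FW W (A × X)} :
    IsParts α αs αo ↔ αs = FW.left ∘ α ∧ αo = FW.right ∘ α := by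
  have h : {u : (X → FW W X) × (X → FW W (A × X)) |
      IsLUB {FW.map Sum.inl ∘ u.1, FW.map Sum.inr ∘ u.2} α} = {(FW.left ∘ α, FW.right ∘ α)} := by
    ext u
    refine FW.isLUB_map_inl_map_inr_iff.trans ⟨?_, ?_⟩
    · rintro rfl
      rfl
    · rintro rfl
      exact funext fun x => (FW.copair_left_right (α x)).symm
  unfold IsParts
  rw [h]
  constructor
  · exact fun h' => Prod.ext_iff.1 (Set.mem_singleton_iff.1 h'.1)
  · rintro ⟨rfl, rfl⟩
    exact isGreatest_singleton

variable [Countable A] (α : TFCoalg W X A) (f : X → C)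

theorem plusReach_apply {c : C} (x : {x // f x ≠ c}) (y : {x // f x = c}) :
    (plusReach α f x.1).1 y.1 = (FW.iterate (classCoalg (FW.left ∘ α) f c) x).1 y := by
  obtain ⟨y, rfl⟩ := y
  exact dif_pos x.2

theorem plusReach_apply_of_eq {x y : X} (h : f x = f y) : (plusReach α f x).1 y = 0 :=
  dif_neg (not_not.2 h)

theorem tauReach_apply_of_eq {x y : X} (h : f x = f y) :
    (tauReach α f x).1 y = (FW.unit x : FW W X).1 y := if_pos h

theorem tauReach_apply_of_ne {x y : X} (h : f x ≠ f y) :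
    (tauReach α f x).1 y = (plusReach α f x).1 y := if_neg h

/-- The class-wise weights of `tauReach` are the reaching weights along `τ*`. -/
theorem map_tauReach_apply (x : X) (c : C) :
    (FW.map f (tauReach α f x)).1 c =
      (coalgEquivWLTS W X A α).reachWeight x (tauStar A) (f ⁻¹' {c}) := by
  by_cases hx : f x = c
  · rw [WLTS.reachWeight_tauStar_of_mem _ (C := f ⁻¹' {c}) hx]
    refine (wsum_eq_single _ (⟨x, hx⟩ : {x // f x = c}) fun y hy => ?_).trans ?_
    · exact (tauReach_apply_of_eq α f (hx.trans y.2.symm)).trans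
        (FW.unit_apply_of_ne fun h => hy (Subtype.ext h))
    · exact (tauReach_apply_of_eq α f rfl).trans (FW.unit_apply_self x)
  · rw [← wsum_iterate_classCoalg α f c ⟨x, hx⟩]
    change wsum _ = wsum _
    congr 1
    funext y
    exact (tauReach_apply_of_ne α f fun h => hx (h.trans y.2)).trans
      (plusReach_apply α f ⟨x, hx⟩ y)

/-- The class-wise weights of the observable part of the saturation are the reaching weights along
`τ* a τ*`. -/
theorem map_flat_apply (x : X) (a : A) (c : C) :
    (FW.map (Prod.map id f) (flat (FW.iterate α) (tauReach α f) x)).1 (a, c) =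
      (coalgEquivWLTS W X A α).reachWeight x (tauStarObs a) (f ⁻¹' {c}) := by
  rw [flat_eq_kcomp, FW.map_kcomp, FW.kcomp_apply, ← wsum_iterate_mul_reachWeight]
  congr 1
  funext v
  congr 1
  refine (map_dist_apply f _ a c).trans ?_
  simp [map_tauReach_apply]

/-- The weak saturation. -/
noncomputable def weakSaturation (x : X) : FW W (X ⊕ (A × X)) :=
  FW.copair (tauReach α f x) (flat (FW.iterate α) (tauReach α f) x)

theorem fmap_weakSaturation_inl (x : X) (c : C) :
    (TFCoalg.fmap f (weakSaturation α f x)).1 (Sum.inl c) =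
      (coalgEquivWLTS W X A α).reachWeight x (tauStar A) (f ⁻¹' {c}) :=
  (FW.map_copair_inl _ _ _ _ _).trans (map_tauReach_apply α f x c)

theorem fmap_weakSaturation_inr (x : X) (a : A) (c : C) :
    (TFCoalg.fmap f (weakSaturation α f x)).1 (Sum.inr (a, c)) =
      (coalgEquivWLTS W X A α).reachWeight x (tauStarObs a) (f ⁻¹' {c}) :=
  (FW.map_copair_inr _ _ _ _ _).trans (map_flat_apply α f x a c)

/-- The saturation descends along a surjection exactly if states in the same class have the same
reaching weights. -/
theorem exists_descent_weakSaturation_iff (hf : Function.Surjective f) :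
    (∃ γ : TFCoalg W C A, γ ∘ f = TFCoalg.fmap f ∘ weakSaturation α f) ↔
      ∀ x x', f x = f x' → ∀ c,
        (∀ a, (coalgEquivWLTS W X A α).reachWeight x (tauStarObs a) (f ⁻¹' {c}) =
          (coalgEquivWLTS W X A α).reachWeight x' (tauStarObs a) (f ⁻¹' {c})) ∧
        (coalgEquivWLTS W X A α).reachWeight x (tauStar A) (f ⁻¹' {c}) =
          (coalgEquivWLTS W X A α).reachWeight x' (tauStar A) (f ⁻¹' {c}) := by
  constructor
  · rintro ⟨γ, hγ⟩ x x' h c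
    have e : TFCoalg.fmap f (weakSaturation α f x) = TFCoalg.fmap f (weakSaturation α f x') := by
      rw [← Function.comp_apply (f := TFCoalg.fmap f), ← hγ,
        ← Function.comp_apply (f := TFCoalg.fmap f), ← hγ, Function.comp_apply,
        Function.comp_apply, h]
    refine ⟨fun a => ?_, ?_⟩
    · rw [← fmap_weakSaturation_inr, e, fmap_weakSaturation_inr]
    · rw [← fmap_weakSaturation_inl, e, fmap_weakSaturation_inl]
  · intro h
    refine ⟨TFCoalg.fmap f ∘ weakSaturation α f ∘ Function.surjInv hf, funext fun x => ?_⟩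
    refine FW.ext_apply ?_
    have hx := h _ x (Function.surjInv_eq hf (f x))
    rintro (c | ⟨a, c⟩)
    · exact (fmap_weakSaturation_inl α f _ c).trans
        ((hx c).2.trans (fmap_weakSaturation_inl α f x c).symm)
    · exact (fmap_weakSaturation_inr α f _ a c).trans
        (((hx c).1 a).trans (fmap_weakSaturation_inr α f x a c).symm)

variable [PartialOrder W] [CanonicallyOrderedAdd W]

/-- The iterate for `c` lives on the class `c`, so at each point at most one member of the family is
nonzero. -/
theorem isLUB_plusReach (x : X) :
    IsLUB {φ | ∃ (c : C) (h : f x ≠ c),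
      φ = FW.map Subtype.val (FW.iterate (classCoalg (FW.left ∘ α) f c) ⟨x, h⟩)}
      (plusReach α f x) := by
  refine FW.isLUB_of_attained ?_ fun y => ?_
  · rintro _ ⟨c, h, rfl⟩ y
    by_cases hy : f y = c
    · exact ((FW.map_val_apply _ ⟨y, hy⟩).trans (plusReach_apply α f ⟨x, h⟩ ⟨y, hy⟩).symm).le
    · refine le_of_eq_of_le (FW.map_val_apply_of_not _ hy) ?_
      exact zero_le (a := (plusReach α f x).1 y)
  · by_cases h : f x = f y
    · exact Or.inl (plusReach_apply_of_eq α f h)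
    · exact Or.inr ⟨_, ⟨f y, h, rfl⟩,
        (FW.map_val_apply (p := fun z => f z = f y) _ ⟨y, rfl⟩).trans
          (plusReach_apply α f (c := f y) ⟨x, h⟩ ⟨y, rfl⟩).symm⟩

/-- The unit lives on the class of `x`, and `plusReach` on the other classes. -/
theorem isLUB_tauReach : IsLUB {FW.unit, plusReach α f} (tauReach α f) := by
  refine FW.isLUB_pair_of_disjoint fun x y => ?_
  by_cases h : f x = f y
  · exact Or.inl ⟨(tauReach_apply_of_eq α f h).symm, plusReach_apply_of_eq α f h⟩
  · exact Or.inr ⟨FW.unit_apply_of_ne fun hy => h (congrArg f hy.symm),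
      (tauReach_apply_of_ne α f h).symm⟩

theorem isTauReach_iff {ατ : X → FW W X} : IsTauReach α f ατ ↔ ατ = tauReach α f := by
  constructor
  · rintro ⟨αs, αo, it, αp, hp, hi, hl, h⟩
    obtain ⟨rfl, rfl⟩ := (isParts_iff α).1 hp
    obtain rfl : it = fun c => FW.iterate (classCoalg (FW.left ∘ α) f c) :=
      funext fun c => FW.isIterate_iff.1 (hi c)
    obtain rfl : αp = plusReach α f := funext fun x => (hl x).unique (isLUB_plusReach α f x)
    exact h.unique (isLUB_tauReach α f)
  · rintro rfl
    exact ⟨_, _, _, _, (isParts_iff α).2 ⟨rfl, rfl⟩, fun c => FW.isIterate_iff.2 rfl,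
      isLUB_plusReach α f, isLUB_tauReach α f⟩

/-- Every auxiliary arrow in the relational definition is determined, so the saturation may be
replaced by an explicit function. -/
theorem isWeakSaturation_iff {αw : TFCoalg W X A} :
    IsWeakSaturation α f αw ↔ αw = weakSaturation α f := by
  constructor
  · rintro ⟨ατ, i, hτ, hi, h⟩
    obtain rfl := (isTauReach_iff α f).1 hτ
    obtain rfl := FW.isIterate_iff.1 hi
    exact FW.isLUB_map_inl_map_inr_iff.1 h
  · rintro rfl
    exact ⟨_, _, (isTauReach_iff α f).2 rfl, FW.isIterate_iff.2 rfl,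
      FW.isLUB_map_inl_map_inr_iff.2 rfl⟩

end Saturation

/-! ### Spans and weak bisimulations -/

theorem IsFinalSpan.spanRel_iff {R X Y C : Type u} {p : R → X} {q : R → Y} {f : X → C}
    {g : Y → C} (h : IsFinalSpan p q f g) {x : X} {y : Y} : spanRel p q x y ↔ f x = g y := by
  constructor
  · rintro ⟨r, rfl, rfl⟩
    exact congrFun h.1 r
  · intro hxy
    -- Finality tested on a one-point span.
    obtain ⟨k, ⟨hp, hq⟩, -⟩ := h.2 PUnit (fun _ => x) (fun _ => y) (funext fun _ => hxy)
    exact ⟨k PUnit.unit, congrFun hp _, congrFun hq _⟩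

theorem JointlyMonic.isFinalSpan {R X Y C : Type u} {p : R → X} {q : R → Y} {f : X → C}
    {g : Y → C} (hm : JointlyMonic p q) (h : ∀ x y, spanRel p q x y ↔ f x = g y) :
    IsFinalSpan p q f g := by
  refine ⟨funext fun r => (h _ _).1 ⟨r, rfl, rfl⟩, fun Z a b hab => ?_⟩
  choose k hk using fun z => (h (a z) (b z)).2 (congrFun hab z)
  refine ⟨k, ⟨funext fun z => (hk z).1, funext fun z => (hk z).2⟩, ?_⟩
  rintro k' ⟨rfl, rfl⟩
  exact funext fun z => hm (Prod.ext (hk z).1.symm (hk z).2.symm)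

section Main

variable {W : Type w} [OmegaSemiring W] {A : Type v} {X : Type u}

/-- A weak bisimulation is a kernel of a surjection whose classes are reached with weights that
depend only on the class of the start. -/
theorem isWeakBisimulation_iff_of_surjective (S : WLTS W X (Option A)) {C : Type*} {f : X → C}
    (hf : Function.Surjective f) {r : X → X → Prop} (hr : ∀ x y, r x y ↔ f x = f y) :
    S.IsWeakBisimulation r ↔ ∀ x x', f x = f x' → ∀ c,
      (∀ a, S.reachWeight x (tauStarObs a) (f ⁻¹' {c}) =
        S.reachWeight x' (tauStarObs a) (f ⁻¹' {c})) ∧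
      S.reachWeight x (tauStar A) (f ⁻¹' {c}) = S.reachWeight x' (tauStar A) (f ⁻¹' {c}) := by
  have heq : Equivalence r :=
    ⟨fun x => (hr x x).2 rfl, fun h => (hr _ _).2 ((hr _ _).1 h).symm,
      fun h h' => (hr _ _).2 (((hr _ _).1 h).trans ((hr _ _).1 h'))⟩
  have hclass : ∀ y, {x | r x y} = f ⁻¹' {f y} := fun y => Set.ext fun x => hr x y
  constructor
  · intro h x x' hxx c
    obtain ⟨y, rfl⟩ := hf c
    have hC : f ⁻¹' {f y} ∈ (Setoid.mk r h.equiv).classes := ⟨y, (hclass y).symm⟩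
    exact ⟨fun a => h.obs x x' ((hr x x').2 hxx) a _ hC,
      h.silent x x' ((hr x x').2 hxx) _ hC⟩
  · intro h
    refine ⟨heq, ?_, ?_⟩
    · rintro x x' hxx a _ ⟨y, rfl⟩
      have := (h x x' ((hr x x').1 hxx) (f y)).1 a
      rwa [← hclass] at this
    · rintro x x' hxx _ ⟨y, rfl⟩
      have := (h x x' ((hr x x').1 hxx) (f y)).2
      rwa [← hclass] at this

variable [PartialOrder W] [CanonicallyOrderedAdd W] [Countable A]

theorem isCoalgWeakBisimulation_iff (α : TFCoalg W X A) {R : Type u} {p q : R → X}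
    (hm : JointlyMonic p q) (hrefl : ∀ x, spanRel p q x x) :
    IsCoalgWeakBisimulation α α p q ↔
      (coalgEquivWLTS W X A α).IsWeakBisimulation (spanRel p q) := by
  constructor
  · rintro ⟨-, C, f, g, αw, βw, γ, hepi, hα, hβ, hf, hg, hfin⟩
    -- Every pair `(x, x)` lies in the relation, so the legs agree at every `x`; joint epicness then
    -- becomes surjectivity of `f`.
    obtain rfl : f = g := funext fun x => hfin.spanRel_iff.1 (hrefl x)
    have hsurj : Function.Surjective f := fun c => (hepi c).elim id id
    obtain rfl := (isWeakSaturation_iff α f).1 hα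
    exact (isWeakBisimulation_iff_of_surjective _ hsurj fun x y => hfin.spanRel_iff).2
      ((exists_descent_weakSaturation_iff α f hsurj).1 ⟨γ, hf⟩)
  · intro h
    let s : Setoid X := ⟨spanRel p q, h.equiv⟩
    let f : X → Quotient s := Quotient.mk s
    have hr : ∀ x y, spanRel p q x y ↔ f x = f y := fun x y => (Quotient.eq (r := s)).symm
    have hsurj : Function.Surjective f := Quotient.mk_surjective
    obtain ⟨γ, hγ⟩ := (exists_descent_weakSaturation_iff α f hsurj).2
      ((isWeakBisimulation_iff_of_surjective _ hsurj hr).1 h)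
    have hw := (isWeakSaturation_iff α f).2 rfl
    exact ⟨hm, Quotient s, f, f, _, _, γ, fun c => Or.inl (hsurj c), hw, hw, hγ, hγ,
      hm.isFinalSpan hr⟩

end Main

theorem mainTheorem4 {W : Type w} [OmegaSemiring W] [PartialOrder W]
    [CanonicallyOrderedAdd W] {A : Type v} [Countable A] {X : Type u} (α : TFCoalg W X A) :
    (∀ (R : Type u) (p q : R → X), JointlyMonic p q → (∀ x, spanRel p q x x) →
      (IsCoalgWeakBisimulation α α p q ↔
        (coalgEquivWLTS W X A α).IsWeakBisimulation (spanRel p q))) ∧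
    (∀ x x' : X, (coalgEquivWLTS W X A α).WeakBisimilar x x' ↔
      ∃ (R : Type u) (p q : R → X), IsCoalgWeakBisimulation α α p q ∧
        Equivalence (spanRel p q) ∧ spanRel p q x x') := by
  refine ⟨fun R p q hm hrefl => isCoalgWeakBisimulation_iff α hm hrefl, fun x x' => ⟨?_, ?_⟩⟩
  · rintro ⟨r, hr, hxx⟩
    -- The relation itself, with its two projections, serves as the span.
    let p : {v : X × X // r v.1 v.2} → X := fun v => v.1.1
    let q : {v : X × X // r v.1 v.2} → X := fun v => v.1.2
    have hpq : spanRel p q = r := by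
      funext y y'
      refine propext ⟨?_, fun h => ⟨⟨(y, y'), h⟩, rfl, rfl⟩⟩
      rintro ⟨v, rfl, rfl⟩
      exact v.2
    have hm : JointlyMonic p q := fun v v' h => Subtype.ext h
    rw [← hpq] at hr hxx
    exact ⟨_, p, q, (isCoalgWeakBisimulation_iff α hm hr.equiv.refl).2 hr, hr.equiv, hxx⟩
  · rintro ⟨R, p, q, h, heq, hxx⟩
    exact ⟨_, (isCoalgWeakBisimulation_iff α h.1 heq.refl).1 h, hxx⟩
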